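/- **Setting.** Let $K$ be a field and $\mathcal D$ a finite-dimensional commutative $K$-algebra; write $\mathcal D=\mathcal D_1\times\cdots\times\mathcal D_t$ with each $\mathcal D_i$ local, and assume that the residue field of every $\mathcal D_i$ is $K$. All rings are commutative with $1$. A $\mathcal D$-ring $(R,e)$ is a $K$-algebra $R$ with a $K$-algebra homomorphism $e\colon R\to R\otimes_K\mathcal D$. It is a $\mathcal D^*$-ring if $(\mathrm{id}_R\otimes\beta)\circ(e\otimes\mathrm{id}_{\mathcal D})\circ e=(e\otimes\mathrm{id}_{\mathcal D})\circ e$, where $\beta(x\otimes y)=y\otimes x$ on $\mathcal D\otimes_K\mathcal D$; equivalently, the operators $\delta_j\colon R\to R$ defined by $e(r)=\sum_j\delta_j(r)\otimes\epsilon_j$ for a basis $(\epsilon_j)$ of $\mathcal D$ commute pairwise. The associated endomorphisms $\sigma_1,\dots,\sigma_t$ of $(R,e)$ are the composites $\sigma_i\colon R\xrightarrow{\,e\,}R\otimes_K\mathcal D\to R\otimes_K K=R$, where the second map is induced by $\mathcal D\to\mathcal D_i\to\mathcal D_i/\mathfrak m_i=K$. An ideal $I$ of $R$ is a $\mathcal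 D$-ideal if $e(I)\subseteq I\otimes_K\mathcal D$ (equivalently, $\delta_j(I)\subseteq I$ for all $j$). A perfect $\mathcal D$-ideal is a radical $\mathcal D$-ideal $I$ such that, for all $a\in R$ and $1\le i\le t$, $a\,\sigma_i(a)\in I$ implies $a\in I$. Given a basis $\epsilon_0,\dots,\epsilon_m$ of $\mathcal D$, the $\mathcal D^*$-polynomial ring $R\{x_1,\dots,x_n\}_{\mathcal D^*}$ is the polynomial ring over $R$ in the algebraically independent variables $d^\theta x_k$ ($1\le k\le n$, $\theta\in\mathbb N^{m+1}$), where $x_k=d^0x_k$, with the unique $\mathcal D$-ring structure extending $e$ such that $d^\theta x_k\mapsto\sum_{j=0}^m d^{\theta+1_j}x_k\otimes\epsilon_j$, where $1_j$ is the $j$-th unit vector. (Up to isomorphism it does not depend on the basis.) **Theorem ($\mathcal D$-Basis Theorem).** Let $(R,e)$ be a $\mathcal D^*$-ring with $R$ a $\mathbb Q$-algebra, and suppose that all associated endomorphisms $\sigma_1,\dots,\sigma_t$ of $(R,e)$ are injective. If $R$ satisfies the ascending chain condition on perfect $\mathcal D$-ideals, then for every $n\ge 0$ and every basis of $\mathcal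 D$ so does $R\{x_1,\dots,x_n\}_{\mathcal D^*}$. -/

import Mathlib

open scoped TensorProduct

noncomputable section

namespace DStar

universe u v w x y

section Rings

variable {K : Type u} [Field K] {D : Type v} [CommRing D] [Algebra K D]
variable {R : Type w} [CommRing R] [Algebra K R]

/-- The functor `𝒟(-) = - ⊗[K] D` on a `K`-algebra homomorphism: `𝒟(φ) = φ ⊗ id`. -/
abbrev mapD (D : Type v) [CommRing D] [Algebra K D] {S : Type x} [CommRing S] [Algebra K S]
    (φ : R →ₐ[K] S) : R ⊗[K] D →ₐ[K] S ⊗[K] D :=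
  Algebra.TensorProduct.map φ (AlgHom.id K D)

/-- A `𝒟`-ring structure on the `K`-algebra `R` is a `K`-algebra homomorphism
`e : R → R ⊗[K] D`. It is a `𝒟*`-ring structure (commuting operators) if
`(id_R ⊗ β) ∘ 𝒟(e) ∘ e = 𝒟(e) ∘ e`, where `β` is the flip of `D ⊗ D`
(`id_R ⊗ β` is the exchange of the last two factors of `(R ⊗ D) ⊗ D`). -/
def IsDStarRing (e : R →ₐ[K] R ⊗[K] D) : Prop :=
  ∀ r : R, TensorProduct.rightComm K R D D (mapD D e (e r)) = mapD D e (e r)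

/-- An ideal `I` of a `𝒟`-ring `(R, e)` is a `𝒟`-ideal if `e(I)` lies in the ideal `I ⊗ D`
of `R ⊗ D`, that is, the ideal generated by the elements `a ⊗ 1` with `a ∈ I`. -/
def IsDIdeal (e : R →ₐ[K] R ⊗[K] D) (I : Ideal R) : Prop :=
  ∀ a ∈ I, e a ∈ I.map (Algebra.TensorProduct.includeLeft : R →ₐ[K] R ⊗[K] D)

end Rings

section LocalFactors

variable (K : Type u) [Field K] (D : Type v) [CommRing D] [Algebra K D]

/-- The local factors of the finite-dimensional algebra `D` are its localizations at its maximal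
ideals; see `bijective_toLocalFactors`. -/
abbrev LocalFactor (m : MaximalSpectrum D) : Type v := Localization.AtPrime m.asIdeal

/-- `D` is the (finite) product of its local factors. -/
theorem bijective_toLocalFactors [Module.Finite K D] :
    Finite (MaximalSpectrum D) ∧
      Function.Bijective
        (algebraMap D (∀ m : MaximalSpectrum D, LocalFactor D m)) := by
  have : IsArtinianRing D := IsArtinianRing.of_finite K D
  refine ⟨inferInstance, MaximalSpectrum.toPiLocalization_injective D, ?_⟩
  have h := (PrimeSpectrum.piLocalizationToMaximal_surjective D).comp
    (PrimeSpectrum.toPiLocalization_bijective (R := D)).2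
  rw [← AlgHom.coe_comp, ← AlgHom.coe_toRingHom] at h
  exact h

/-- Every local factor of `D` has residue field `K`. -/
def HasResidueFieldsK : Prop :=
  ∀ m : MaximalSpectrum D,
    Function.Bijective (algebraMap K (IsLocalRing.ResidueField (LocalFactor D m)))

variable {K D}

/-- The projection of `D` onto the local factor at `m`, followed by the projection of this factor
onto its residue field `K`. -/
def residueProj (h : HasResidueFieldsK K D) (m : MaximalSpectrum D) : D →ₐ[K] K :=
  ((AlgEquiv.ofBijective
      (Algebra.ofId K (IsLocalRing.ResidueField (LocalFactor D m))) (h m)).symm.toAlgHom).comp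
    (IsScalarTower.toAlgHom K D (IsLocalRing.ResidueField (LocalFactor D m)))

variable {R : Type w} [CommRing R] [Algebra K R]

/-- The endomorphism `σ` of `(R, e)` associated with the local factor of `D` at `m`: the composite
`R → R ⊗ D → R ⊗ K = R` of `e` with the projection onto the residue field of this factor. -/
def assocEnd (h : HasResidueFieldsK K D) (e : R →ₐ[K] R ⊗[K] D) (m : MaximalSpectrum D) :
    R →ₐ[K] R :=
  ((Algebra.TensorProduct.rid K K R).toAlgHom.comp
    (Algebra.TensorProduct.map (AlgHom.id K R) (residueProj h m))).comp e

/-- A `𝒟`-ideal `I` is reflexive if `a * σ a ∈ I` implies `a ∈ I` for every associated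
endomorphism `σ`. -/
def IsReflexiveDIdeal (h : HasResidueFieldsK K D) (e : R →ₐ[K] R ⊗[K] D) (I : Ideal R) : Prop :=
  IsDIdeal e I ∧ ∀ (m : MaximalSpectrum D) (a : R), a * assocEnd h e m a ∈ I → a ∈ I

/-- A perfect `𝒟`-ideal is a reflexive `𝒟`-ideal that is a radical ideal. -/
def IsPerfectDIdeal (h : HasResidueFieldsK K D) (e : R →ₐ[K] R ⊗[K] D) (I : Ideal R) : Prop :=
  IsReflexiveDIdeal h e I ∧ I.IsRadical

/-- The ascending chain condition on perfect `𝒟`-ideals of `(R, e)`. -/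
def ACCPerfect (h : HasResidueFieldsK K D) (e : R →ₐ[K] R ⊗[K] D) : Prop :=
  ∀ I : ℕ → Ideal R, Monotone I → (∀ k, IsPerfectDIdeal h e (I k)) →
    ∃ N, ∀ k, N ≤ k → I k = I N

end LocalFactors

section Polynomials

variable {K : Type u} [Field K] {D : Type v} [CommRing D] [Algebra K D]

/-- The `𝒟*`-polynomial ring over `R` in indeterminates `x_i`, `i : X`, with respect to a basis
of `D` indexed by `ι`: the polynomial ring in the variables `d^θ x_i`, which are
`MvPolynomial.X (i, θ)`, with `θ` a tuple of natural numbers indexed by `ι`. -/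
abbrev DPoly (X : Type x) (ι : Type y) (R : Type w) [CommRing R] : Type (max w x y) :=
  MvPolynomial (X × (ι →₀ ℕ)) R

variable {R : Type w} [CommRing R] [Algebra K R] {ι : Type y} [Fintype ι]

/-- The `𝒟`-ring structure `e'` on the `𝒟*`-polynomial ring: it extends `e` and sends `d^θ x_i`
to `∑ j, d^(θ + 1_j) x_i ⊗ ε_j`; see `dPolyMap_C`, `dPolyMap_X` and `dPolyMap_unique`. -/
def dPolyMap (X : Type x) (b : Module.Basis ι K D) (e : R →ₐ[K] R ⊗[K] D) :
    DPoly X ι R →ₐ[K] DPoly X ι R ⊗[K] D where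
  toRingHom :=
    MvPolynomial.eval₂Hom
      ((mapD D (IsScalarTower.toAlgHom K R (DPoly X ι R))).comp e).toRingHom
      (fun p => ∑ j, (MvPolynomial.X (p.1, p.2 + Finsupp.single j 1) : DPoly X ι R) ⊗ₜ[K] b j)
  commutes' := fun c => by
    change MvPolynomial.eval₂Hom _ _ (algebraMap K (MvPolynomial (X × (ι →₀ ℕ)) R) c) = _
    rw [IsScalarTower.algebraMap_apply K R (MvPolynomial (X × (ι →₀ ℕ)) R),
      MvPolynomial.algebraMap_eq]
    exact (MvPolynomial.eval₂_C _ _ _).trans (by simp)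

theorem dPolyMap_C (X : Type x) (b : Module.Basis ι K D) (e : R →ₐ[K] R ⊗[K] D) (r : R) :
    dPolyMap X b e (MvPolynomial.C r) =
      mapD D (IsScalarTower.toAlgHom K R (DPoly X ι R)) (e r) :=
  MvPolynomial.eval₂_C _ _ _

theorem dPolyMap_X (X : Type x) (b : Module.Basis ι K D) (e : R →ₐ[K] R ⊗[K] D)
    (i : X) (θ : ι →₀ ℕ) :
    dPolyMap X b e (MvPolynomial.X (i, θ)) =
      ∑ j, (MvPolynomial.X (i, θ + Finsupp.single j 1) : DPoly X ι R) ⊗ₜ[K] b j :=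
  MvPolynomial.eval₂_X _ _ _

theorem dPolyMap_unique (X : Type x) (b : Module.Basis ι K D) (e : R →ₐ[K] R ⊗[K] D)
    (f : DPoly X ι R →ₐ[K] DPoly X ι R ⊗[K] D)
    (hC : ∀ r, f (MvPolynomial.C r) = mapD D (IsScalarTower.toAlgHom K R (DPoly X ι R)) (e r))
    (hX : ∀ i θ, f (MvPolynomial.X (i, θ)) =
      ∑ j, (MvPolynomial.X (i, θ + Finsupp.single j 1) : DPoly X ι R) ⊗ₜ[K] b j) :
    f = dPolyMap X b e := by
  apply AlgHom.coe_ringHom_injective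
  apply MvPolynomial.ringHom_ext
  · intro r
    exact (hC r).trans (dPolyMap_C X b e r).symm
  · rintro ⟨i, θ⟩
    exact (hX i θ).trans (dPolyMap_X X b e i θ).symm

end Polynomials

end DStar

end

/-! The proof follows the Ritt–Raudenbush pattern, with the operators of an adapted basis of `D` in
the role of derivations and endomorphisms.

Since all residue fields are `K`, the `D`-module `Module.Dual K D` has a filtration by submodules
with one-dimensional quotients, each spanned by an eigenvector whose eigenvalue is a residue
projection. Its dual basis (`exists_adapted_basis`) gives commuting operators `d j` such that `d (s
j)` is an associated endomorphism and, when `s j ≠ j`, `d j` is a `d (s j)`-derivation up to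
products of operators of index larger than `j` (`isTriangular_op`). Variables are ordered so that a
larger index shifts less, hence these errors only involve smaller variables.

Triangularity makes perfect ideals stable under colons (`IsOpPerfect.colon`). It follows that if
some perfect ideal is not finitely generated, then there is a prime such ideal `P` that is maximal
among them. For each leading variable of a relation modulo `P`, take a relation of least degree; its
initial and, in characteristic zero, its separant lie outside `P`. Dickson's lemma selects finitely
many of these relations. Together with generators of the contraction of `P` to `R` they generate a
perfect ideal `J ≤ P`. Let `h ∉ P` be the product of their initials and separants.

Modulo the colon ideal of `J` by `h`, these initials and separants are regular. Regular relations
propagate along all shifts (`HasRegularRelation.shift`): an endomorphism acts on coefficients, while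
a twisted derivation yields a linear relation whose initial is the twisted separant. Pseudo-division
(`le_of_hasRegularRelation`) then gives `h * P ⊆ J`. As `P` and `h` generate a finitely generated
perfect ideal by maximality, so does `P` alone (`PerfectFG.of_insert`), a contradiction. -/

noncomputable section

namespace DStar

/-! ### Perfect ideals, colons and maximal counterexamples -/

section Perfect

variable {K : Type*} [Field K] {ι : Type*} {S : Type*} [CommRing S] [Algebra K S]

/-- Perfect ideals with respect to a family of operators: radical ideals `I` stable under the
operators `d j`, such that `a * d (s j) a ∈ I` implies `a ∈ I`. -/
structure IsOpPerfect (s : ι → ι) (d : ι → S →ₗ[K] S) (I : Ideal S) : Prop where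
  map_mem : ∀ j, ∀ a ∈ I, d j a ∈ I
  reflexive : ∀ j a, a * d (s j) a ∈ I → a ∈ I
  radical : I.IsRadical

/-- The smallest perfect ideal containing a set. -/
def perfectSpan (s : ι → ι) (d : ι → S →ₗ[K] S) (A : Set S) : Ideal S :=
  sInf {I | IsOpPerfect s d I ∧ A ⊆ I}

/-- Perfect ideals which are finitely generated as perfect ideals. -/
def PerfectFG (s : ι → ι) (d : ι → S →ₗ[K] S) (I : Ideal S) : Prop :=
  ∃ A : Finset S, I = perfectSpan s d A

section Span

variable {s : ι → ι} {d : ι → S →ₗ[K] S}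

theorem IsOpPerfect.mem_of_sq {I : Ideal S} (hI : IsOpPerfect s d I) {a : S} (h : a * a ∈ I) :
    a ∈ I :=
  hI.radical ⟨2, by rwa [pow_two]⟩

theorem isOpPerfect_sInf {C : Set (Ideal S)} (h : ∀ I ∈ C, IsOpPerfect s d I) :
    IsOpPerfect s d (sInf C) where
  map_mem j a ha := by
    rw [Submodule.mem_sInf] at ha ⊢
    exact fun I hI => (h I hI).map_mem j a (ha I hI)
  reflexive j a ha := by
    rw [Submodule.mem_sInf] at ha ⊢
    exact fun I hI => (h I hI).reflexive j a (ha I hI)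
  radical a ha := by
    obtain ⟨n, hn⟩ := ha
    rw [Submodule.mem_sInf] at hn ⊢
    exact fun I hI => (h I hI).radical ⟨n, hn I hI⟩

theorem isOpPerfect_perfectSpan (A : Set S) : IsOpPerfect s d (perfectSpan s d A) :=
  isOpPerfect_sInf fun _ hI => hI.1

theorem subset_perfectSpan (A : Set S) : A ⊆ perfectSpan s d A := fun a ha => by
  rw [perfectSpan, SetLike.mem_coe, Submodule.mem_sInf]
  exact fun I hI => hI.2 ha

theorem perfectSpan_le {A : Set S} {I : Ideal S} (hI : IsOpPerfect s d I) (h : A ⊆ I) :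
    perfectSpan s d A ≤ I :=
  sInf_le ⟨hI, h⟩

theorem perfectSpan_mono {A B : Set S} (h : A ⊆ B) : perfectSpan s d A ≤ perfectSpan s d B :=
  perfectSpan_le (isOpPerfect_perfectSpan B) (h.trans (subset_perfectSpan B))

/-- A nonempty directed union of perfect ideals is perfect. -/
theorem isOpPerfect_iSup {α : Type*} [Nonempty α] (I : α → Ideal S)
    (hdir : Directed (· ≤ ·) I) (h : ∀ i, IsOpPerfect s d (I i)) :
    IsOpPerfect s d (⨆ i, I i) := by
  have hmem : ∀ a, a ∈ ⨆ i, I i ↔ ∃ i, a ∈ I i := fun a => Submodule.mem_iSup_of_directed I hdir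
  refine ⟨fun j a ha => ?_, fun j a ha => ?_, fun a ha => ?_⟩
  · obtain ⟨i, hi⟩ := (hmem _).1 ha
    exact (hmem _).2 ⟨i, (h i).map_mem j a hi⟩
  · obtain ⟨i, hi⟩ := (hmem _).1 ha
    exact (hmem _).2 ⟨i, (h i).reflexive j a hi⟩
  · obtain ⟨n, hn⟩ := ha
    obtain ⟨i, hi⟩ := (hmem _).1 hn
    exact (hmem _).2 ⟨i, (h i).radical ⟨n, hi⟩⟩

/-- A finitely generated perfect ideal which is a directed union of ideals is one of them. -/
theorem exists_eq_of_iSup_fg {α : Type*} [Nonempty α] {I : α → Ideal S}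
    (hdir : Directed (· ≤ ·) I) (h : ∀ i, IsOpPerfect s d (I i))
    (hfg : PerfectFG s d (⨆ i, I i)) : ∃ i, I i = ⨆ i, I i := by
  obtain ⟨A, hA⟩ := hfg
  have hmem : ∀ a, a ∈ ⨆ i, I i ↔ ∃ i, a ∈ I i := fun a => Submodule.mem_iSup_of_directed I hdir
  have hsub : ∀ a ∈ A, ∃ i, a ∈ I i := fun a ha =>
    (hmem a).1 (hA ▸ subset_perfectSpan (A : Set S) ha)
  have key : ∃ i, (A : Set S) ⊆ I i := by
    classical
    choose! f hf using hsub
    obtain ⟨i, hi⟩ := hdir.finset_le (A.image f)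
    exact ⟨i, fun a ha => hi (f a) (Finset.mem_image_of_mem f ha) (hf a ha)⟩
  obtain ⟨i, hi⟩ := key
  exact ⟨i, le_antisymm (le_iSup I i) (hA ▸ perfectSpan_le (h i) hi)⟩

/-- If `P ∪ {a}` generates a finitely generated perfect ideal, then finitely many elements of the
perfect ideal `P`, together with `a`, generate it. -/
theorem exists_finset_perfectSpan_insert (P : Ideal S) (a : S)
    (h : PerfectFG s d (perfectSpan s d (insert a (P : Set S)))) :
    ∃ T : Finset S, (T : Set S) ⊆ P ∧
      perfectSpan s d (insert a (P : Set S)) = perfectSpan s d (insert a (T : Set S)) := by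
  let α := {T : Finset S // (T : Set S) ⊆ P}
  let I : α → Ideal S := fun T => perfectSpan s d (insert a (T.1 : Set S))
  have : Nonempty α := ⟨⟨∅, by simp⟩⟩
  classical
  have hdir : Directed (· ≤ ·) I := fun T U =>
    ⟨⟨T.1 ∪ U.1, by simp [T.2, U.2]⟩,
      perfectSpan_mono (Set.insert_subset_insert (by simp)),
      perfectSpan_mono (Set.insert_subset_insert (by simp))⟩
  have hI : ∀ T, IsOpPerfect s d (I T) := fun T => isOpPerfect_perfectSpan _
  have heq : ⨆ T, I T = perfectSpan s d (insert a (P : Set S)) := by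
    refine le_antisymm (iSup_le fun T => perfectSpan_mono (Set.insert_subset_insert T.2))
      (perfectSpan_le (isOpPerfect_iSup I hdir hI) ?_)
    rintro x (rfl | hx)
    · exact (le_iSup I ⟨∅, by simp⟩) (subset_perfectSpan _ (Set.mem_insert _ _))
    · exact (le_iSup I ⟨{x}, by simpa using hx⟩)
        (subset_perfectSpan _ (Set.mem_insert_of_mem _ (by simp)))
  rw [← heq] at h
  obtain ⟨T, hT⟩ := exists_eq_of_iSup_fg hdir hI h
  exact ⟨T.1, T.2, by rw [← heq, ← hT]⟩

/-- If all perfect ideals are finitely generated, then ascending chains stabilize. -/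
theorem exists_stable_of_perfectFG (h : ∀ I : Ideal S, IsOpPerfect s d I → PerfectFG s d I)
    (I : ℕ → Ideal S) (hmono : Monotone I) (hI : ∀ k, IsOpPerfect s d (I k)) :
    ∃ N, ∀ k, N ≤ k → I k = I N := by
  have hdir : Directed (· ≤ ·) I := hmono.directed_le
  obtain ⟨N, hN⟩ := exists_eq_of_iSup_fg hdir hI (h _ (isOpPerfect_iSup I hdir hI))
  exact ⟨N, fun k hk => le_antisymm (hN ▸ le_iSup I k) (hmono hk)⟩

/-- If ascending chains of perfect ideals stabilize, then perfect ideals are finitely generated. -/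
theorem perfectFG_of_stable
    (h : ∀ I : ℕ → Ideal S, Monotone I → (∀ k, IsOpPerfect s d (I k)) →
      ∃ N, ∀ k, N ≤ k → I k = I N)
    {P : Ideal S} (hP : IsOpPerfect s d P) : PerfectFG s d P := by
  classical
  by_contra hcon
  have step : ∀ A : Finset S, ∃ x, (A : Set S) ⊆ P → x ∈ P ∧ x ∉ perfectSpan s d (A : Set S) := by
    intro A
    by_contra! hA
    refine hcon ⟨A, le_antisymm (fun x hx => ?_) (perfectSpan_le hP (hA 0).1)⟩
    exact (hA x).2 hx
  choose f hf using step
  obtain ⟨T, hT0, hT⟩ : ∃ T : ℕ → Finset S, T 0 = ∅ ∧ ∀ n, T (n + 1) = insert (f (T n)) (T n) :=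
    ⟨fun n => Nat.rec ∅ (fun _ A => insert (f A) A) n, rfl, fun _ => rfl⟩
  have hTP : ∀ n, (T n : Set S) ⊆ P := by
    intro n
    induction n with
    | zero => simp [hT0]
    | succ n ih =>
      rw [hT, Finset.coe_insert]
      exact Set.insert_subset (hf _ ih).1 ih
  obtain ⟨N, hN⟩ := h (fun n => perfectSpan s d (T n : Set S))
    (monotone_nat_of_le_succ fun n => perfectSpan_mono (by rw [hT]; simp))
    fun n => isOpPerfect_perfectSpan _
  refine (hf _ (hTP N)).2 ?_
  have := hN (N + 1) (Nat.le_succ N)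
  rw [← this]
  exact subset_perfectSpan _ (by rw [hT]; simp)

end Span

variable [LinearOrder ι] [Fintype ι]

/-- A triangular family of commuting operators: the operators `d (s j)` are ring endomorphisms, and
if `s j ≠ j`, then `d j` is a `d (s j)`-derivation up to a bilinear error in the operators `d k`
with `j < k`. -/
structure IsTriangular (s : ι → ι) (c : ι → ι → ι → K) (d : ι → S →ₗ[K] S) : Prop where
  comm : ∀ i j a, d i (d j a) = d j (d i a)
  le_s : ∀ j, j ≤ s j
  one : ∀ j, d (s j) 1 = 1
  mul_s : ∀ j a b, d (s j) (a * b) = d (s j) a * d (s j) b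
  mul : ∀ j, s j ≠ j → ∀ a b, d j (a * b) = d (s j) a * d j b + d j a * d (s j) b +
    ∑ k with j < k, ∑ l with j < l, c j k l • (d k a * d l b)

variable {s : ι → ι} {c : ι → ι → ι → K} {d : ι → S →ₗ[K] S}

/-- The ring endomorphism `d (s j)` of a triangular family. -/
def IsTriangular.toEnd (hd : IsTriangular s c d) (j : ι) : S →+* S where
  toFun := d (s j)
  map_one' := hd.one j
  map_mul' := hd.mul_s j
  map_zero' := map_zero _
  map_add' := map_add _

theorem IsTriangular.toEnd_apply (hd : IsTriangular s c d) (j : ι) (a : S) :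
    hd.toEnd j a = d (s j) a := rfl

/-- Reflexivity for `x * r`: its product with its own image is a multiple of `x * r * d (s j) r`. A
factor `d (s j) r` may thus be dropped in the presence of `r`. -/
theorem IsOpPerfect.mem_of_mul_end_mem (hd : IsTriangular s c d) {I : Ideal S}
    (hI : IsOpPerfect s d I) {r x : S} {j : ι} (h : x * r * d (s j) r ∈ I) : x * r ∈ I := by
  refine hI.reflexive j _ ?_
  rw [hd.mul_s, show x * r * (d (s j) x * d (s j) r) = d (s j) x * (x * r * d (s j) r) by ring]
  exact I.mul_mem_left _ h

/-- Descending induction on `j`. Expanding `t * d j (a * t)` by the product rule, every term except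
`d j a * t * d (s j) t` contains `d k a * t` for some `k > j`, so lies in `I`; the factor `d (s j)
t` is then dropped. For an endomorphism, `t * d j (a * t)` is already that term. -/
theorem IsOpPerfect.op_mul_mem (hd : IsTriangular s c d) {I : Ideal S}
    (hI : IsOpPerfect s d I) {a t : S} (h : a * t ∈ I) (j : ι) : d j a * t ∈ I := by
  induction j using WellFoundedGT.induction with | _ j ih
  by_cases hj : s j = j
  · refine hI.mem_of_mul_end_mem hd (j := j) ?_
    rw [show d j a * t * d (s j) t = t * d (s j) (a * t) by rw [hd.mul_s, hj]; ring]
    exact I.mul_mem_left _ (hI.map_mem _ _ h)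
  · refine hI.mem_of_mul_end_mem hd (j := j) ?_
    have h1 := I.mul_mem_left t (hI.map_mem j _ h)
    rw [hd.mul j hj] at h1
    have h2 : t * (d (s j) a * d j t) ∈ I := by
      rw [show t * (d (s j) a * d j t) = d j t * (d (s j) a * t) by ring]
      exact I.mul_mem_left _ (ih _ (lt_of_le_of_ne (hd.le_s j) (Ne.symm hj)))
    have h3 : t * ∑ k with j < k, ∑ l with j < l, c j k l • (d k a * d l t) ∈ I := by
      simp only [Finset.mul_sum]
      refine I.sum_mem fun k hk => I.sum_mem fun l _ => ?_
      rw [mul_smul_comm, ← algebraMap_smul S, smul_eq_mul,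
        show t * (d k a * d l t) = d l t * (d k a * t) by ring]
      exact I.mul_mem_left _ (I.mul_mem_left _ (ih k (by simpa using hk)))
    rw [show d j a * t * d (s j) t = t * (d (s j) a * d j t + d j a * d (s j) t +
      ∑ k with j < k, ∑ l with j < l, c j k l • (d k a * d l t)) - t * (d (s j) a * d j t) -
      t * ∑ k with j < k, ∑ l with j < l, c j k l • (d k a * d l t) by ring]
    exact I.sub_mem (I.sub_mem h1 h2) h3

/-- Perfect ideals are closed under colon by an element. -/
theorem IsOpPerfect.colon (hd : IsTriangular s c d) {I : Ideal S} (hI : IsOpPerfect s d I)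
    (t : S) : IsOpPerfect s d (I.colon {t}) := by
  refine ⟨fun j a ha => ?_, fun j a ha => ?_, fun a ha => ?_⟩
  · rw [Submodule.mem_colon_singleton, smul_eq_mul] at ha ⊢
    exact hI.op_mul_mem hd ha j
  · rw [Submodule.mem_colon_singleton, smul_eq_mul] at ha ⊢
    refine hI.reflexive j _ ?_
    rw [hd.mul_s, show a * t * (d (s j) a * d (s j) t) = d (s j) t * (a * d (s j) a * t) by ring]
    exact I.mul_mem_left _ ha
  · obtain ⟨n, hn⟩ := ha
    rw [Submodule.mem_colon_singleton, smul_eq_mul] at hn ⊢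
    refine hI.radical ⟨n + 1, ?_⟩
    rw [show (a * t) ^ (n + 1) = a * t ^ n * (a ^ n * t) by ring]
    exact I.mul_mem_left _ hn

/-- The colon of `I` by `t` is perfect, so it contains the whole perfect span as soon as it contains
`A`. This replaces any explicit construction of the perfect span. -/
theorem perfectSpan_mul_mem (hd : IsTriangular s c d) {A : Set S} {I : Ideal S}
    (hI : IsOpPerfect s d I) {t x : S} (h : ∀ a ∈ A, a * t ∈ I) (hx : x ∈ perfectSpan s d A) :
    x * t ∈ I := by
  have := perfectSpan_le (hI.colon hd t) (A := A)
    (fun a ha => Submodule.mem_colon_singleton.2 (h a ha)) hx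
  exact Submodule.mem_colon_singleton.1 this

/-- A perfect ideal `P` is finitely generated if `P` and `a` together generate a finitely
generated perfect ideal and `a * P` lies in a finitely generated perfect ideal inside `P`. -/
theorem PerfectFG.of_insert (hd : IsTriangular s c d) {P J : Ideal S} {a : S}
    (hP : IsOpPerfect s d P) (h : PerfectFG s d (perfectSpan s d (insert a (P : Set S))))
    (hJ : PerfectFG s d J) (hJP : J ≤ P) (haJ : ∀ p ∈ P, a * p ∈ J) : PerfectFG s d P := by
  classical
  obtain ⟨T, hTP, hT⟩ := exists_finset_perfectSpan_insert P a h
  obtain ⟨U, rfl⟩ := hJ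
  refine ⟨T ∪ U, le_antisymm (fun p hp => ?_) (perfectSpan_le hP ?_)⟩
  · have hspan := isOpPerfect_perfectSpan (s := s) (d := d) ((T ∪ U : Finset S) : Set S)
    -- Here `p` plays two roles: as an element of the span of `a` and `T`, and as the multiplier
    -- sending these generators into the span of `T ∪ U`. Hence `p * p` lies there.
    refine hspan.mem_of_sq (perfectSpan_mul_mem hd hspan
      (A := insert a (T : Set S)) (fun x hx => ?_) ?_)
    · rcases hx with rfl | hx
      · exact perfectSpan_mono (by simp) (haJ p hp)
      · exact Ideal.mul_mem_right _ _ (subset_perfectSpan _ (by simp [Finset.mem_coe.1 hx]))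
    · rw [← hT]
      exact subset_perfectSpan _ (Set.mem_insert_of_mem _ hp)
  · rw [Finset.coe_union]
    exact Set.union_subset hTP ((subset_perfectSpan _).trans hJP)

/-- If some perfect ideal is not finitely generated, then there is a prime one which is maximal
among them. -/
theorem exists_maximal_not_perfectFG (hd : IsTriangular s c d) {I : Ideal S}
    (hI : IsOpPerfect s d I) (hfg : ¬ PerfectFG s d I) :
    ∃ P : Ideal S, IsOpPerfect s d P ∧ ¬ PerfectFG s d P ∧ P.IsPrime ∧
      ∀ Q, IsOpPerfect s d Q → P < Q → PerfectFG s d Q := by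
  obtain ⟨P, -, hP⟩ := zorn_le_nonempty₀ {P | IsOpPerfect s d P ∧ ¬ PerfectFG s d P}
    (fun C hC hchain Q hQ => by
      have : Nonempty C := ⟨⟨Q, hQ⟩⟩
      have hdir : Directed (· ≤ ·) (fun P : C => (P : Ideal S)) := hchain.directed
      refine ⟨⨆ P : C, (P : Ideal S), ⟨isOpPerfect_iSup _ hdir fun P => (hC P.2).1,
        fun h => ?_⟩, fun P hP => le_iSup (fun P : C => (P : Ideal S)) ⟨P, hP⟩⟩
      obtain ⟨P, hP⟩ := exists_eq_of_iSup_fg hdir (fun P => (hC P.2).1) h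
      exact (hC P.2).2 (hP ▸ h)) I ⟨hI, hfg⟩
  obtain ⟨⟨hP, hPfg⟩, hmax⟩ := hP
  have hmax' : ∀ Q, IsOpPerfect s d Q → P < Q → PerfectFG s d Q := fun Q hQ hlt => by
    by_contra hcon
    exact hlt.not_ge (hmax ⟨hQ, hcon⟩ hlt.le)
  have hins : ∀ b ∉ P, PerfectFG s d (perfectSpan s d (insert b (P : Set S))) := fun b hb =>
    hmax' _ (isOpPerfect_perfectSpan _) (lt_of_le_of_ne
      ((Set.subset_insert _ _).trans (subset_perfectSpan _))
      fun heq => hb (heq ▸ subset_perfectSpan _ (Set.mem_insert _ _)))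
  refine ⟨P, hP, hPfg, ⟨fun htop => hPfg ⟨{1}, ?_⟩, fun {a b} hab => ?_⟩, hmax'⟩
  · rw [htop, eq_comm, Ideal.eq_top_iff_one]
    exact subset_perfectSpan _ (by simp)
  · by_contra! hcon
    have hlt : P < P.colon {b} := lt_of_le_of_ne Ideal.le_colon fun heq => hcon.1 (by
      rw [heq]
      exact Submodule.mem_colon_singleton.2 hab)
    obtain ⟨U, hU⟩ := hmax' _ (hP.colon hd b) hlt
    classical
    -- With `U` generating the colon of `P` by `b`, the products `u * b` generate a perfect ideal
    -- between `b * P` and `P`.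
    refine hPfg (PerfectFG.of_insert hd hP (hins b hcon.2) ⟨U.image (· * b), rfl⟩
      (perfectSpan_le hP ?_) fun p hp => ?_)
    · intro x hx
      obtain ⟨u, hu, rfl⟩ := Finset.mem_image.1 (Finset.mem_coe.1 hx)
      exact Submodule.mem_colon_singleton.1 (hU ▸ subset_perfectSpan _ hu)
    · rw [mul_comm]
      refine perfectSpan_mul_mem hd (isOpPerfect_perfectSpan _) (A := (U : Set S))
        (fun u hu => subset_perfectSpan _ ?_) (hU ▸ hlt.le hp)
      exact Finset.mem_coe.2 (Finset.mem_image_of_mem (· * b) hu)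

end Perfect

/-! ### Relations, pseudo-division and their behaviour under operators -/

section Reduction

open Polynomial

variable {K : Type*} [Field K] {ι : Type*} {S : Type*} [CommRing S] [Algebra K S]
variable {R : Type*} [CommRing R] [Algebra R S]
variable {V : Type*} [LinearOrder V]

/-- The subalgebra generated by the variables `y w` with `w < v`. -/
abbrev lowerAlg (R : Type*) [CommRing R] [Algebra R S] (y : V → S) (v : V) : Subalgebra R S :=
  Algebra.adjoin R (y '' Set.Iio v)

/-- A system of ordered variables `y v`, permuted by the operators through shifts `sh j` which are
strictly increasing on `V` and strictly decreasing in the index `j`. -/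
structure IsVariableSystem [LT ι] (d : ι → S →ₗ[K] S) (y : V → S) (sh : ι → V → V) : Prop where
  op_var : ∀ j v, d j (y v) = y (sh j v)
  strictMono : ∀ j, StrictMono (sh j)
  index_lt : ∀ {j k} v, j < k → sh k v < sh j v

/-- Elements regular modulo `J`. -/
def IsRegularMod (J : Ideal S) (r : S) : Prop := ∀ x, r * x ∈ J → x ∈ J

/-- There is a polynomial relation of degree at most `n` for `y v` modulo `J` over the smaller
variables, whose initial and separant are regular modulo `J`. -/
def HasRegularRelation (R : Type*) [CommRing R] [Algebra R S] (y : V → S) (J : Ideal S) (v : V)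
    (n : ℕ) : Prop :=
  0 < n ∧ ∃ p : S[X], (∀ i, p.coeff i ∈ lowerAlg R y v) ∧ p.natDegree ≤ n ∧ p.eval (y v) ∈ J ∧
    IsRegularMod J p.leadingCoeff ∧ IsRegularMod J (p.derivative.eval (y v))

/-- There is a polynomial of degree exactly `n` modulo `P` over the smaller variables which
vanishes modulo `P` at `y v`. -/
def HasRelation (R : Type*) [CommRing R] [Algebra R S] (y : V → S) (P : Ideal S) (v : V)
    (n : ℕ) : Prop :=
  ∃ p : S[X], (∀ i, p.coeff i ∈ lowerAlg R y v) ∧ p.natDegree ≤ n ∧ p.eval (y v) ∈ P ∧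
    p.coeff n ∉ P

theorem eval_mem_of_coeff_mem {B : Subalgebra R S} {p : S[X]} (hp : ∀ i, p.coeff i ∈ B) {a : S}
    (ha : a ∈ B) : p.eval a ∈ B := by
  rw [eval_eq_sum_range]
  exact B.sum_mem fun i _ => B.mul_mem (hp i) (B.pow_mem ha i)

theorem coeff_derivative_mem {B : Subalgebra R S} {p : S[X]} (hp : ∀ i, p.coeff i ∈ B) (i : ℕ) :
    p.derivative.coeff i ∈ B := by
  rw [coeff_derivative]
  exact B.mul_mem (hp _) (B.add_mem (natCast_mem B i) B.one_mem)

theorem eval_mem_adjoin_Iic {y : V → S} {v : V} {p : S[X]}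
    (hp : ∀ i, p.coeff i ∈ lowerAlg R y v) :
    p.eval (y v) ∈ Algebra.adjoin R (y '' Set.Iic v) :=
  eval_mem_of_coeff_mem
    (fun i => Algebra.adjoin_mono (Set.image_mono Set.Iio_subset_Iic_self) (hp i))
    (Algebra.subset_adjoin ⟨v, le_rfl, rfl⟩)

theorem exists_eval_eq_of_mem_adjoin_Iic {y : V → S} {v : V} {a : S}
    (ha : a ∈ Algebra.adjoin R (y '' Set.Iic v)) :
    ∃ p : S[X], (∀ i, p.coeff i ∈ lowerAlg R y v) ∧ p.eval (y v) = a := by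
  induction ha using Algebra.adjoin_induction with
  | mem x hx =>
    obtain ⟨w, hw, rfl⟩ := hx
    rcases (Set.mem_Iic.1 hw).lt_or_eq with hlt | rfl
    · refine ⟨C (y w), fun i => ?_, by simp⟩
      rw [coeff_C]
      split_ifs
      · exact Algebra.subset_adjoin ⟨w, hlt, rfl⟩
      · exact zero_mem _
    · refine ⟨X, fun i => ?_, by simp⟩
      rw [coeff_X]
      split_ifs
      · exact one_mem _
      · exact zero_mem _
  | algebraMap r =>
    refine ⟨C (algebraMap R S r), fun i => ?_, by simp⟩
    rw [coeff_C]
    split_ifs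
    · exact algebraMap_mem _ r
    · exact zero_mem _
  | add a b _ _ ha hb =>
    obtain ⟨p, hp, rfl⟩ := ha
    obtain ⟨q, hq, rfl⟩ := hb
    exact ⟨p + q, fun i => by rw [coeff_add]; exact add_mem (hp i) (hq i), by simp⟩
  | mul a b _ _ ha hb =>
    obtain ⟨p, hp, rfl⟩ := ha
    obtain ⟨q, hq, rfl⟩ := hb
    exact ⟨p * q, fun i => by
      rw [coeff_mul]; exact sum_mem fun x _ => mul_mem (hp _) (hq _), by simp⟩

/-- An element involves only finitely many variables, so it is a constant or has a largest one; this
feeds the induction on the leading variable. -/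
theorem mem_range_or_exists_mem_adjoin_Iic {y : V → S} {T : Set V} {a : S}
    (ha : a ∈ Algebra.adjoin R (y '' T)) :
    (∃ r, algebraMap R S r = a) ∨ ∃ w ∈ T, a ∈ Algebra.adjoin R (y '' Set.Iic w) := by
  have hbin : ∀ (f : S → S → S) (_ : ∀ (B : Subalgebra R S), ∀ a ∈ B, ∀ b ∈ B, f a b ∈ B)
      (a b : S),
      ((∃ r, algebraMap R S r = a) ∨ ∃ w ∈ T, a ∈ Algebra.adjoin R (y '' Set.Iic w)) →
      ((∃ r, algebraMap R S r = b) ∨ ∃ w ∈ T, b ∈ Algebra.adjoin R (y '' Set.Iic w)) →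
      ((∃ r, algebraMap R S r = f a b) ∨ ∃ w ∈ T, f a b ∈ Algebra.adjoin R (y '' Set.Iic w)) := by
    rintro f hf a b (⟨r, rfl⟩ | ⟨w, hw, ha⟩) (⟨r', rfl⟩ | ⟨w', hw', hb⟩)
    · exact .inl (Algebra.mem_bot.1
        (hf ⊥ _ (Algebra.mem_bot.2 ⟨r, rfl⟩) _ (Algebra.mem_bot.2 ⟨r', rfl⟩)))
    · exact .inr ⟨w', hw', hf _ _ (algebraMap_mem _ r) _ hb⟩
    · exact .inr ⟨w, hw, hf _ _ ha _ (algebraMap_mem _ r')⟩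
    · have hmono : ∀ {u u' : V}, u ≤ u' → Algebra.adjoin R (y '' Set.Iic u) ≤
          Algebra.adjoin R (y '' Set.Iic u') := fun h =>
        Algebra.adjoin_mono (Set.image_mono (Set.Iic_subset_Iic.2 h))
      rcases le_total w w' with h | h
      · exact .inr ⟨w', hw', hf _ _ (hmono h ha) _ hb⟩
      · exact .inr ⟨w, hw, hf _ _ ha _ (hmono h hb)⟩
  induction ha using Algebra.adjoin_induction with
  | mem x hx =>
    obtain ⟨w, hw, rfl⟩ := hx
    exact .inr ⟨w, hw, Algebra.subset_adjoin ⟨w, le_rfl, rfl⟩⟩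
  | algebraMap r => exact .inl ⟨r, rfl⟩
  | add a b _ _ ha hb => exact hbin (· + ·) (fun B a ha b hb => B.add_mem ha hb) a b ha hb
  | mul a b _ _ ha hb => exact hbin (· * ·) (fun B a ha b hb => B.mul_mem ha hb) a b ha hb

/-- Reduction of a relation for one variable. -/
theorem eval_mem_of_hasRegularRelation {y : V → S} {P J : Ideal S} (hJP : J ≤ P) {v : V}
    (hlow : ∀ a ∈ lowerAlg R y v, a ∈ P → a ∈ J)
    (hrel : ∀ n, HasRelation R y P v n → ∃ m ≤ n, HasRegularRelation R y J v m)
    {p : S[X]} (hp : ∀ i, p.coeff i ∈ lowerAlg R y v) (hpP : p.eval (y v) ∈ P) :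
    p.eval (y v) ∈ J := by
  induction hn : p.natDegree using Nat.strong_induction_on generalizing p with | _ n ih
  rcases Nat.eq_zero_or_pos n with rfl | hpos
  · rw [eq_C_of_natDegree_eq_zero hn, eval_C] at hpP ⊢
    exact hlow _ (hp 0) hpP
  by_cases hlc : p.leadingCoeff ∈ P
  · have herase : p.eraseLead.eval (y v) + p.leadingCoeff * y v ^ p.natDegree = p.eval (y v) := by
      have := congrArg (eval (y v)) (eraseLead_add_C_mul_X_pow p)
      rwa [eval_add, eval_C_mul, eval_X_pow] at this
    have hlcJ : p.leadingCoeff * y v ^ p.natDegree ∈ J :=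
      J.mul_mem_right _ (hlow _ (hp _) hlc)
    have hE : ∀ i, p.eraseLead.coeff i ∈ lowerAlg R y v := fun i => by
      rw [eraseLead_coeff]
      split_ifs
      · exact zero_mem _
      · exact hp i
    rw [← herase]
    refine J.add_mem (ih p.eraseLead.natDegree ?_ hE ?_ rfl) hlcJ
    · have := eraseLead_natDegree_le p
      omega
    · rw [← eq_sub_iff_add_eq] at herase
      rw [herase]
      exact P.sub_mem hpP (hJP hlcJ)
  · obtain ⟨m, hm, -, q, hq, hqm, hqJ, hreg, -⟩ := hrel n ⟨p, hp, hn.le, hpP, by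
      rwa [← hn, coeff_natDegree]⟩
    have hqp : q.natDegree ≤ p.natDegree := by omega
    -- One step of pseudo-division: `q.cancelLeads p` has smaller degree and still vanishes modulo
    -- `P`. The factor `q.leadingCoeff` this costs is removed by regularity.
    refine hreg _ ?_
    have hev : (q.cancelLeads p).eval (y v) = q.leadingCoeff * p.eval (y v) -
        p.leadingCoeff * y v ^ (p.natDegree - q.natDegree) * q.eval (y v) := by
      simp [cancelLeads, Nat.sub_eq_zero_of_le hqp]
    have hmem := J.mul_mem_left (p.leadingCoeff * y v ^ (p.natDegree - q.natDegree)) hqJ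
    rw [← sub_add_cancel (q.leadingCoeff * p.eval (y v)), ← hev]
    refine J.add_mem (ih (q.cancelLeads p).natDegree ?_ (fun i => ?_) ?_ rfl) hmem
    · rw [← hn]
      exact natDegree_cancelLeads_lt_of_natDegree_le_natDegree hqp (by omega)
    · rw [cancelLeads, coeff_sub, mul_assoc, mul_assoc, coeff_C_mul, coeff_C_mul,
        coeff_X_pow_mul', coeff_X_pow_mul']
      refine sub_mem (mul_mem (hq _) ?_) (mul_mem (hp _) ?_)
      · split_ifs
        · exact hp _
        · exact zero_mem _
      · split_ifs
        · exact hq _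
        · exact zero_mem _
    · rw [hev]
      exact P.sub_mem (P.mul_mem_left _ hpP) (hJP hmem)

/-- An ideal `J ≤ P` contains `P` if it does so on constants, and every relation modulo `P` is
matched by a regular relation modulo `J`. -/
theorem le_of_hasRegularRelation [WellFoundedLT V] {y : V → S}
    (hgen : Algebra.adjoin R (Set.range y) = ⊤) {P J : Ideal S} (hJP : J ≤ P)
    (hconst : ∀ r, algebraMap R S r ∈ P → algebraMap R S r ∈ J)
    (hrel : ∀ v n, HasRelation R y P v n → ∃ m ≤ n, HasRegularRelation R y J v m) : P ≤ J := by
  have hred : ∀ v, (∀ a ∈ lowerAlg R y v, a ∈ P → a ∈ J) →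
      ∀ a ∈ Algebra.adjoin R (y '' Set.Iic v), a ∈ P → a ∈ J := by
    intro v hlow a ha haP
    obtain ⟨p, hp, rfl⟩ := exists_eval_eq_of_mem_adjoin_Iic ha
    exact eval_mem_of_hasRegularRelation hJP hlow (hrel v) hp haP
  have hall : ∀ v, ∀ a ∈ lowerAlg R y v, a ∈ P → a ∈ J := by
    intro v
    induction v using WellFoundedLT.induction with | _ v ih
    intro a ha haP
    rcases mem_range_or_exists_mem_adjoin_Iic ha with ⟨r, rfl⟩ | ⟨w, hw, haw⟩
    · exact hconst r haP
    · exact hred w (ih w hw) a haw haP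
  intro a haP
  have ha : a ∈ Algebra.adjoin R (y '' Set.univ) := by
    rw [Set.image_univ, hgen]
    trivial
  rcases mem_range_or_exists_mem_adjoin_Iic ha with ⟨r, rfl⟩ | ⟨w, -, haw⟩
  · exact hconst r haP
  · exact hred w (hall w) a haw haP

variable [LinearOrder ι] [Fintype ι]
variable {s : ι → ι} {c : ι → ι → ι → K} {d : ι → S →ₗ[K] S}

theorem IsOpPerfect.isRegularMod_end (hd : IsTriangular s c d) {J : Ideal S}
    (hJ : IsOpPerfect s d J) {r : S} (hr : IsRegularMod J r) (j : ι) :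
    IsRegularMod J (d (s j) r) := by
  intro x hx
  refine hr x ?_
  rw [mul_comm]
  refine hJ.mem_of_mul_end_mem hd (j := j) ?_
  rw [show x * r * d (s j) r = r * (d (s j) r * x) by ring]
  exact J.mul_mem_left _ hx

variable [Algebra K R] [IsScalarTower K R S]

/-- The claim is proved for all `k ≥ j` at once, because the product rule for `d k` involves `d (s
k)` and operators of larger index. -/
theorem op_mem_of_mem_adjoin (hd : IsTriangular s c d)
    (hR : ∀ j r, ∃ r', d j (algebraMap R S r) = algebraMap R S r') {A : Set S}
    {B : Subalgebra R S} {j : ι} (h : ∀ k, j ≤ k → ∀ a ∈ A, d k a ∈ B) {a : S}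
    (ha : a ∈ Algebra.adjoin R A) : ∀ k, j ≤ k → d k a ∈ B := by
  induction ha using Algebra.adjoin_induction with
  | mem x hx => exact fun k hk => h k hk x hx
  | algebraMap r =>
    intro k _
    obtain ⟨r', hr'⟩ := hR k r
    rw [hr']
    exact algebraMap_mem _ _
  | add a b _ _ ha hb =>
    intro k hk
    rw [map_add]
    exact add_mem (ha k hk) (hb k hk)
  | mul a b _ _ ha hb =>
    intro k hk
    by_cases hs : s k = k
    · have := hd.mul_s k a b
      rw [hs] at this
      rw [this]
      exact mul_mem (ha k hk) (hb k hk)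
    · have hsk := hk.trans (hd.le_s k)
      rw [hd.mul k hs]
      refine add_mem (add_mem (mul_mem (ha _ hsk) (hb k hk)) (mul_mem (ha k hk) (hb _ hsk)))
        (sum_mem fun l hl => sum_mem fun l' hl' => ?_)
      rw [← algebraMap_smul R]
      rw [Finset.mem_filter] at hl hl'
      exact B.smul_mem (mul_mem (ha l (hk.trans hl.2.le)) (hb l' (hk.trans hl'.2.le))) _

variable {y : V → S} {sh : ι → V → V}

theorem IsVariableSystem.op_mem_lowerAlg (hy : IsVariableSystem d y sh)
    (hd : IsTriangular s c d) (hR : ∀ j r, ∃ r', d j (algebraMap R S r) = algebraMap R S r')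
    {v : V} {j k : ι} (hjk : j ≤ k) {a : S} (ha : a ∈ lowerAlg R y v) :
    d k a ∈ lowerAlg R y (sh j v) := by
  refine op_mem_of_mem_adjoin hd hR (j := j) (fun k hk a ha => ?_) ha k hjk
  obtain ⟨w, hw, rfl⟩ := ha
  rw [hy.op_var]
  refine Algebra.subset_adjoin ⟨_, ?_, rfl⟩
  refine lt_of_le_of_lt ?_ (hy.strictMono j hw)
  rcases hk.lt_or_eq with hlt | rfl
  · exact (hy.index_lt w hlt).le
  · exact le_rfl

/-- For `j < k` the variable `y v` itself is allowed, since `sh k v` is strictly below `sh j v`.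
Hence error terms never contain the new leading variable `y (sh j v)`. -/
theorem IsVariableSystem.op_mem_lowerAlg_of_Iic (hy : IsVariableSystem d y sh)
    (hd : IsTriangular s c d) (hR : ∀ j r, ∃ r', d j (algebraMap R S r) = algebraMap R S r')
    {v : V} {j k : ι} (hjk : j < k) {a : S} (ha : a ∈ Algebra.adjoin R (y '' Set.Iic v)) :
    d k a ∈ lowerAlg R y (sh j v) := by
  refine op_mem_of_mem_adjoin hd hR (j := k) (fun l hl a ha => ?_) ha k le_rfl
  obtain ⟨w, hw, rfl⟩ := ha
  rw [hy.op_var]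
  exact Algebra.subset_adjoin
    ⟨_, (hy.index_lt w (hjk.trans_le hl)).trans_le ((hy.strictMono j).monotone hw), rfl⟩

/-- An operator which is not an endomorphism turns a polynomial in `y v` into a linear polynomial
in the shifted variable, whose initial is the twisted separant. -/
theorem IsVariableSystem.exists_op_eval_eq (hy : IsVariableSystem d y sh)
    (hd : IsTriangular s c d) (hR : ∀ j r, ∃ r', d j (algebraMap R S r) = algebraMap R S r')
    {v : V} {j : ι} (hj : s j ≠ j) {p : S[X]} (hp : ∀ i, p.coeff i ∈ lowerAlg R y v) :
    ∃ g ∈ lowerAlg R y (sh j v),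
      d j (p.eval (y v)) = d (s j) (p.derivative.eval (y v)) * y (sh j v) + g := by
  induction hn : p.natDegree generalizing p with
  | zero =>
    rw [eq_C_of_natDegree_eq_zero hn]
    exact ⟨d j (p.coeff 0), hy.op_mem_lowerAlg hd hR le_rfl (hp 0), by simp⟩
  | succ n ih =>
    have hq : ∀ i, p.divX.coeff i ∈ lowerAlg R y v := fun i => by
      rw [coeff_divX]
      exact hp _
    obtain ⟨g, hg, hgeq⟩ := ih hq (by rw [natDegree_divX_eq_natDegree_tsub_one, hn]; rfl)
    set a := p.divX.eval (y v)
    set a' := p.divX.derivative.eval (y v)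
    have h1 : p.eval (y v) = y v * a + p.coeff 0 := by
      have := congrArg (eval (y v)) (divX_mul_X_add p)
      rw [eval_add, eval_mul, eval_X, eval_C] at this
      rw [← this, mul_comm]
    have h2 : p.derivative.eval (y v) = a + y v * a' := by
      have := congrArg (fun q => eval (y v) (derivative q)) (divX_mul_X_add p)
      simp only [derivative_add, derivative_mul, derivative_X, derivative_C, eval_add, eval_mul,
        eval_X, mul_one, add_zero] at this
      rw [← this]
      ring
    -- Product rule for `y v * a`, where `d j a` is known by induction. The coefficient of `y (sh j
    -- v)` collects to `d (s j) (a + y v * a')`, the twisted separant; everything else is the new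
    -- lower part.
    refine ⟨d (s j) (y v) * g + ∑ k with j < k, ∑ l with j < l, c j k l • (d k (y v) * d l a) +
      d j (p.coeff 0), ?_, ?_⟩
    · have hyv : ∀ k, j < k → d k (y v) ∈ lowerAlg R y (sh j v) := fun k hk =>
        hy.op_mem_lowerAlg_of_Iic hd hR hk (Algebra.subset_adjoin ⟨v, le_rfl, rfl⟩)
      refine add_mem (add_mem
        (mul_mem (hyv _ (lt_of_le_of_ne (hd.le_s j) (Ne.symm hj))) hg)
        (sum_mem fun k hk => sum_mem fun l hl => ?_)) (hy.op_mem_lowerAlg hd hR le_rfl (hp 0))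
      rw [← algebraMap_smul R]
      rw [Finset.mem_filter] at hk hl
      exact Subalgebra.smul_mem _ (mul_mem (hyv k hk.2)
        (hy.op_mem_lowerAlg_of_Iic hd hR hl.2 (eval_mem_adjoin_Iic hq))) _
    · rw [h1, h2, map_add, hd.mul j hj, hgeq, map_add, hd.mul_s, hy.op_var j v]
      ring

/-- Reflexivity of `J` keeps initials and separants regular under the endomorphisms, so the twisted
separant can serve as both initial and separant of the new linear relation. -/
theorem HasRegularRelation.shift (hy : IsVariableSystem d y sh) (hd : IsTriangular s c d)
    (hR : ∀ j r, ∃ r', d j (algebraMap R S r) = algebraMap R S r') {J : Ideal S}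
    (hJ : IsOpPerfect s d J) {v : V} {n : ℕ} (h : HasRegularRelation R y J v n) (j : ι) :
    HasRegularRelation R y J (sh j v) n := by
  obtain ⟨hn, p, hp, hpn, hpJ, hlc, hsep⟩ := h
  by_cases hj : s j = j
  · have hmap : ∀ q : S[X], (q.map (hd.toEnd j)).eval (y (sh j v)) = d j (q.eval (y v)) := by
      intro q
      have := hd.toEnd_apply j (y v)
      rw [hj, hy.op_var] at this
      rw [← this, eval_map_apply, hd.toEnd_apply, hj]
    by_cases hJtop : J = ⊤
    · exact ⟨hn, 0, by simp, by simp, by simp, fun x _ => by simp [hJtop],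
        fun x _ => by simp [hJtop]⟩
    -- For a proper `J` a regular element is nonzero, so the degree does not drop under the
    -- coefficient map.
    have hne : hd.toEnd j p.leadingCoeff ≠ 0 := fun h0 => hJtop ((Ideal.eq_top_iff_one J).2
      (hJ.isRegularMod_end hd hlc j 1 (by rw [← hd.toEnd_apply, h0, zero_mul]; exact J.zero_mem)))
    refine ⟨hn, p.map (hd.toEnd j), fun i => ?_, natDegree_map_le.trans hpn, ?_, ?_, ?_⟩
    · rw [coeff_map, hd.toEnd_apply]
      exact hy.op_mem_lowerAlg hd hR (hd.le_s j) (hp i)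
    · rw [hmap]
      exact hJ.map_mem j _ hpJ
    · rw [leadingCoeff_map_of_leadingCoeff_ne_zero _ hne]
      exact hJ.isRegularMod_end hd hlc j
    · rw [derivative_map, hmap, ← hj]
      exact hJ.isRegularMod_end hd hsep j
  · obtain ⟨g, hg, heq⟩ := hy.exists_op_eval_eq hd hR hj hp
    have hreg := hJ.isRegularMod_end hd hsep j
    set r := d (s j) (p.derivative.eval (y v)) with hr
    have hrmem : r ∈ lowerAlg R y (sh j v) :=
      hy.op_mem_lowerAlg_of_Iic hd hR (lt_of_le_of_ne (hd.le_s j) (Ne.symm hj))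
        (eval_mem_adjoin_Iic (coeff_derivative_mem hp))
    by_cases hr0 : r = 0
    · have hJtop : J = ⊤ := (Ideal.eq_top_iff_one J).2
        (hreg 1 (by rw [hr0, zero_mul]; exact J.zero_mem))
      exact ⟨hn, 0, by simp, by simp, by simp, fun x _ => by simp [hJtop],
        fun x _ => by simp [hJtop]⟩
    -- The new relation has degree at most `1`, which is at most `n` because relations are required
    -- to have `0 < n`.
    refine ⟨hn, C r * X + C g, fun i => ?_, natDegree_linear_le.trans hn, ?_, ?_, ?_⟩
    · rw [coeff_add, coeff_C_mul, coeff_X, coeff_C]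
      refine add_mem (mul_mem hrmem ?_) ?_
      · split_ifs
        · exact one_mem _
        · exact zero_mem _
      · split_ifs
        · exact hg
        · exact zero_mem _
    · simpa [← heq] using hJ.map_mem j _ hpJ
    · rwa [leadingCoeff_linear hr0]
    · simpa using hreg

end Reduction

/-! ### Dickson's lemma and the basis theorem for triangular operators -/

section Basis

open Polynomial

/-- Dickson's lemma: every set in a well-quasi-ordered partial order is dominated by finitely many
of its elements. -/
theorem exists_finset_forall_exists_le {α : Type*} [PartialOrder α] [WellQuasiOrderedLE α]
    (A : Set α) : ∃ F : Finset α, (F : Set α) ⊆ A ∧ ∀ a ∈ A, ∃ f ∈ F, f ≤ a := by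
  have hfin : {a | Minimal (· ∈ A) a}.Finite :=
    WellQuasiOrderedLE.finite_of_isAntichain (setOfPred_minimal_antichain _)
  refine ⟨hfin.toFinset, fun a ha => ?_, fun a ha => ?_⟩
  · exact (hfin.mem_toFinset.1 (Finset.mem_coe.1 ha)).prop
  · obtain ⟨m, hm, hmin⟩ := exists_minimal_le_of_wellFoundedLT (· ∈ A) a ha
    exact ⟨m, hfin.mem_toFinset.2 hmin, hm⟩

/-- The index set of the variables `d^θ x_k`, ordered lexicographically. -/
abbrev VarIndex (ι : Type*) (n : ℕ) : Type _ := Fin n ×ₗ Lex (ι → ℕ)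

variable {ι : Type*} [LinearOrder ι] {n : ℕ}

/-- The shift `d^θ x_k ↦ d^(θ + 1_j) x_k` of the variables. -/
def varShift (j : ι) (v : VarIndex ι n) : VarIndex ι n :=
  toLex ((ofLex v).1, (ofLex v).2 + toLex (Pi.single j 1))

theorem varShift_strictMono (j : ι) : StrictMono (varShift (n := n) j) := by
  intro v w h
  rw [Prod.Lex.lt_iff] at h ⊢
  rcases h with h | ⟨h, h'⟩
  · exact .inl h
  · exact .inr ⟨h, add_lt_add_left h' _⟩

theorem varShift_lt {j k : ι} (v : VarIndex ι n) (h : j < k) : varShift k v < varShift j v := by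
  rw [Prod.Lex.lt_iff]
  refine .inr ⟨rfl, add_lt_add_right ?_ _⟩
  refine ⟨j, fun i hi => ?_, ?_⟩
  · simp [hi.ne, (hi.trans h).ne]
  · simp [h.ne]

variable [Fintype ι]

theorem reflTransGen_varShift (k : Fin n) (θ : ι → ℕ) :
    ∀ θ' : ι → ℕ, θ ≤ θ' → Relation.ReflTransGen (fun v w => ∃ j, w = varShift j v)
      (toLex (k, toLex θ) : VarIndex ι n) (toLex (k, toLex θ')) := by
  suffices H : ∀ (m : ℕ) (θ' : ι → ℕ), θ ≤ θ' → ∑ i, (θ' i - θ i) = m →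
      Relation.ReflTransGen (fun v w => ∃ j, w = varShift j v)
        (toLex (k, toLex θ) : VarIndex ι n) (toLex (k, toLex θ')) from
    fun θ' h => H _ θ' h rfl
  intro m
  induction m with
  | zero =>
    intro θ' h hm
    have : θ = θ' := le_antisymm h fun i => by
      exact Nat.sub_eq_zero_iff_le.1 ((Finset.sum_eq_zero_iff.1 hm) i (Finset.mem_univ i))
    rw [this]
  | succ m ih =>
    intro θ' h hm
    obtain ⟨j, -, hj⟩ := Finset.exists_ne_zero_of_sum_ne_zero (hm.trans_ne (Nat.succ_ne_zero m))
    have hdec : Pi.single j 1 ≤ θ' := by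
      intro i
      rcases eq_or_ne i j with rfl | hij
      · simp
        omega
      · simp [hij]
    have heq : θ' - Pi.single j 1 + Pi.single j 1 = θ' := tsub_add_cancel_of_le hdec
    have hle : θ ≤ θ' - Pi.single j 1 := by
      intro i
      have := h i
      rcases eq_or_ne i j with rfl | hij
      · simp
        omega
      · simpa [hij] using this
    refine (ih (θ' - Pi.single j 1) hle ?_).tail ⟨j, ?_⟩
    · have : ∑ i, (θ' i - θ i) = ∑ i, ((θ' - Pi.single j 1 : ι → ℕ) i - θ i) +
        ∑ i, (Pi.single j 1 : ι → ℕ) i := by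
        rw [← Finset.sum_add_distrib]
        refine Finset.sum_congr rfl fun i _ => ?_
        have h1 := hle i
        have h2 := congrFun heq i
        simp only [Pi.sub_apply, Pi.add_apply] at h1 h2 ⊢
        omega
      rw [hm, Finset.sum_pi_single'] at this
      simpa using this.symm
    · change _ = toLex (k, toLex (θ' - Pi.single j 1) + toLex (Pi.single j 1))
      rw [← toLex_add, heq]

/-- Finitely many variables of bounded degree dominate a set of variables with degrees. -/
theorem exists_finset_varShift (L : Set (VarIndex ι n)) (δ : VarIndex ι n → ℕ) :
    ∃ F : Finset (VarIndex ι n), (F : Set (VarIndex ι n)) ⊆ L ∧ ∀ v ∈ L, ∃ w ∈ F,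
      Relation.ReflTransGen (fun v w => ∃ j, w = varShift j v) w v ∧ δ w ≤ δ v := by
  classical
  -- The degree enters Dickson's lemma as an extra coordinate, so that the dominating variable also
  -- has no larger degree.
  have key : ∀ k : Fin n, ∃ F : Finset ((ι → ℕ) × ℕ),
      (F : Set ((ι → ℕ) × ℕ)) ⊆ {p | toLex (k, toLex p.1) ∈ L ∧ δ (toLex (k, toLex p.1)) = p.2} ∧
      ∀ a ∈ {p : (ι → ℕ) × ℕ | toLex (k, toLex p.1) ∈ L ∧ δ (toLex (k, toLex p.1)) = p.2},
        ∃ f ∈ F, f ≤ a := fun k => exists_finset_forall_exists_le _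
  choose F hF hdom using key
  refine ⟨Finset.univ.biUnion fun k => (F k).image fun p => toLex (k, toLex p.1), ?_, ?_⟩
  · intro v hv
    obtain ⟨k, -, hv⟩ := Finset.mem_biUnion.1 (Finset.mem_coe.1 hv)
    obtain ⟨p, hp, rfl⟩ := Finset.mem_image.1 hv
    exact (hF k hp).1
  · intro v hv
    obtain ⟨p, hp, hle⟩ := hdom (ofLex v).1 (ofLex (ofLex v).2, δ v) ⟨hv, rfl⟩
    refine ⟨toLex ((ofLex v).1, toLex p.1), Finset.mem_biUnion.2
      ⟨_, Finset.mem_univ _, Finset.mem_image_of_mem _ hp⟩, ?_, ?_⟩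
    · exact reflTransGen_varShift _ _ _ hle.1
    · rw [(hF _ hp).2]
      exact hle.2

variable {K : Type*} [Field K] {S : Type*} [CommRing S] [Algebra K S]

-- The operators generate a commutative subalgebra of endomorphisms, where finite products of powers
-- make sense without an order of the factors.
open scoped IsMulCommutative in
theorem exists_monomial_operators {d : ι → S →ₗ[K] S} (hd : ∀ i j a, d i (d j a) = d j (d i a)) :
    ∃ Φ : (ι → ℕ) → S →ₗ[K] S, (∀ a, Φ 0 a = a) ∧
      ∀ θ j a, Φ (θ + Pi.single j 1) a = d j (Φ θ a) := by
  obtain ⟨E, hE⟩ : ∃ E : ι → Module.End K S, E = d := ⟨d, rfl⟩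
  have hcomm : ∀ a ∈ Set.range E, ∀ b ∈ Set.range E, a * b = b * a := by
    rw [hE]
    rintro _ ⟨i, rfl⟩ _ ⟨j, rfl⟩
    exact LinearMap.ext fun a => hd i j a
  have := Algebra.isMulCommutative_adjoin K hcomm
  let D : ι → Algebra.adjoin K (Set.range E) := fun j => ⟨E j, Algebra.subset_adjoin ⟨j, rfl⟩⟩
  refine ⟨fun θ => ((∏ j, D j ^ θ j : Algebra.adjoin K (Set.range E)) : Module.End K S),
    fun a => by simp, fun θ j a => ?_⟩
  have : ∏ i, D i ^ (θ + Pi.single j 1 : ι → ℕ) i = D j * ∏ i, D i ^ θ i := by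
    simp only [Pi.add_apply, pow_add, Finset.prod_mul_distrib]
    rw [mul_comm]
    congr 1
    rw [Finset.prod_eq_single j (fun i _ hi => by simp [hi]) (by simp)]
    simp
  rw [← hE]
  exact congrArg (fun u : Algebra.adjoin K (Set.range E) => (u : Module.End K S) a) this

theorem exists_isVariableSystem {d : ι → S →ₗ[K] S} (hd : ∀ i j a, d i (d j a) = d j (d i a))
    (x : Fin n → S) :
    ∃ y : VarIndex ι n → S, IsVariableSystem d y varShift ∧
      ∀ k, y (toLex (k, toLex 0)) = x k := by
  obtain ⟨Φ, hΦ0, hΦ⟩ := exists_monomial_operators hd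
  exact ⟨fun v => Φ (ofLex (ofLex v).2) (x (ofLex v).1),
    ⟨fun j v => (hΦ _ _ _).symm, varShift_strictMono, varShift_lt⟩, fun k => hΦ0 _⟩

variable {R : Type*} [CommRing R] [Algebra R S] [Algebra K R] [IsScalarTower K R S]
variable {s : ι → ι} {c : ι → ι → ι → K} {d : ι → S →ₗ[K] S} {dR : ι → R →ₗ[K] R}

/-- The coefficient of degree `m - 1` of the derivative is `m` times `p.coeff m`, and `m` is a unit
over `ℚ`. So a relation of least degree has its separant outside a prime `P`. -/
theorem HasRelation.derivative {V : Type*} [LinearOrder V] {y : V → S} [Algebra ℚ S] {P : Ideal S}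
    {v : V} {m : ℕ} (hm : m ≠ 0) {p : S[X]} (hp : ∀ i, p.coeff i ∈ lowerAlg R y v)
    (hpm : p.natDegree ≤ m) (hcoeff : p.coeff m ∉ P) (h : p.derivative.eval (y v) ∈ P) :
    HasRelation R y P v (m - 1) := by
  refine ⟨p.derivative, coeff_derivative_mem hp, (natDegree_derivative_le p).trans (by omega), h,
    fun hmem => hcoeff ?_⟩
  rw [coeff_derivative, ← Nat.cast_succ, Nat.succ_eq_add_one,
    Nat.sub_add_cancel (Nat.pos_of_ne_zero hm)] at hmem
  have hunit : IsUnit (m : S) := by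
    have := (IsUnit.mk0 (m : ℚ) (Nat.cast_ne_zero.2 hm)).map (algebraMap ℚ S)
    rwa [map_natCast] at this
  exact (Ideal.mul_unit_mem_iff_mem P hunit).1 hmem

/-- The basis theorem for triangular families of operators: over a `ℚ`-algebra, finite generation
of perfect ideals passes to finitely generated extensions. -/
theorem perfectFG_of_adjoin_eq_top [Algebra ℚ S] (hd : IsTriangular s c d)
    (hcompat : ∀ j r, d j (algebraMap R S r) = algebraMap R S (dR j r))
    (hR : ∀ I : Ideal R, IsOpPerfect s dR I → PerfectFG s dR I) {y : VarIndex ι n → S}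
    (hy : IsVariableSystem d y varShift) (hgen : Algebra.adjoin R (Set.range y) = ⊤)
    (I : Ideal S) (hI : IsOpPerfect s d I) : PerfectFG s d I := by
  classical
  by_contra hcon
  obtain ⟨P, hP, hPfg, hprime, hmax⟩ := exists_maximal_not_perfectFG hd hI hcon
  have hcomap : ∀ {J : Ideal S}, IsOpPerfect s d J →
      IsOpPerfect s dR (J.comap (algebraMap R S)) := fun {J} hJ =>
    ⟨fun j a ha => by
      rw [Ideal.mem_comap, ← hcompat]
      exact hJ.map_mem j _ ha,
    fun j a ha => hJ.reflexive j _ (by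
      rw [Ideal.mem_comap, map_mul, ← hcompat] at ha
      exact ha),
    hJ.radical.comap _⟩
  obtain ⟨T, hT⟩ := hR _ (hcomap hP)
  -- The least degree of a relation at `v`; the value `0` where there is none is never used.
  have hmin : ∀ v, ∃ m, (∃ k, HasRelation R y P v k) →
      HasRelation R y P v m ∧ ∀ k, HasRelation R y P v k → m ≤ k := by
    intro v
    by_cases h : ∃ k, HasRelation R y P v k
    · exact ⟨Nat.find h, fun _ => ⟨Nat.find_spec h, fun k hk => Nat.find_min' h hk⟩⟩
    · exact ⟨0, fun h' => absurd h' h⟩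
  choose δ hδ using hmin
  obtain ⟨F, hFL, hF⟩ := exists_finset_varShift {v | ∃ k, HasRelation R y P v k} δ
  have hδpos : ∀ v, (∃ k, HasRelation R y P v k) → δ v ≠ 0 := by
    intro v hv h0
    obtain ⟨p, -, hdeg, hev, hcoeff⟩ := (hδ v hv).1
    rw [h0] at hdeg hcoeff
    rw [eq_C_of_natDegree_le_zero hdeg, eval_C] at hev
    exact hcoeff hev
  have hex : ∀ v, ∃ q : S[X], (∃ k, HasRelation R y P v k) →
      (∀ i, q.coeff i ∈ lowerAlg R y v) ∧ q.natDegree ≤ δ v ∧ q.eval (y v) ∈ P ∧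
        q.leadingCoeff * q.derivative.eval (y v) ∉ P := by
    intro v
    by_cases hv : ∃ k, HasRelation R y P v k
    · obtain ⟨q, hq, hdeg, hev, hcoeff⟩ := (hδ v hv).1
      refine ⟨q, fun _ => ⟨hq, hdeg, hev, fun hmem => ?_⟩⟩
      rcases hprime.mem_or_mem hmem with h | h
      · have hdeg' : q.natDegree = δ v := le_antisymm hdeg
          (le_natDegree_of_ne_zero fun h0 => hcoeff (h0 ▸ P.zero_mem))
        exact hcoeff (hdeg' ▸ h)
      · have := (hδ v hv).2 _ (HasRelation.derivative (hδpos v hv) hq hdeg hcoeff h)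
        have := hδpos v hv
        omega
    · exact ⟨0, fun h => absurd h hv⟩
  choose q hq using hex
  let h : S := ∏ v ∈ F, (q v).leadingCoeff * (q v).derivative.eval (y v)
  have hh : h ∉ P := fun hmem => by
    obtain ⟨v, hv, hvP⟩ := hprime.prod_mem_iff.1 hmem
    exact (hq v (hFL hv)).2.2.2 hvP
  let A : Finset S := F.image (fun v => (q v).eval (y v)) ∪ T.image (algebraMap R S)
  have hAP : (A : Set S) ⊆ P := by
    intro a ha
    rcases Finset.mem_union.1 (Finset.mem_coe.1 ha) with ha | ha
    · obtain ⟨v, hv, rfl⟩ := Finset.mem_image.1 ha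
      exact (hq v (hFL hv)).2.2.1
    · obtain ⟨r, hr, rfl⟩ := Finset.mem_image.1 ha
      have : r ∈ P.comap (algebraMap R S) := hT ▸ subset_perfectSpan _ hr
      exact this
  set J := perfectSpan s d (A : Set S) with hJdef
  have hJ : IsOpPerfect s d J := isOpPerfect_perfectSpan _
  have hJP : J ≤ P := perfectSpan_le hP hAP
  have hJ' := hJ.colon hd h
  have hJJ' : J ≤ J.colon {h} := Ideal.le_colon
  have hJ'P : J.colon {h} ≤ P := fun a ha =>
    (hprime.mem_or_mem (hJP (Submodule.mem_colon_singleton.1 ha))).resolve_right hh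
  have hreg : ∀ r, r ∣ h → IsRegularMod (J.colon {h}) r := by
    rintro r ⟨u, hu⟩ x hx
    rw [Submodule.mem_colon_singleton, smul_eq_mul] at hx ⊢
    refine hJ.mem_of_sq ?_
    -- As `r` divides `h`, the square of `x * h` is a multiple of `r * x * h`, and `J` is radical.
    rw [show x * h * (x * h) = x * u * (r * x * h) by rw [hu]; ring]
    exact J.mul_mem_left _ hx
  refine hPfg (PerfectFG.of_insert hd hP (a := h) (J := J) (hmax _ (isOpPerfect_perfectSpan _)
    (lt_of_le_of_ne ((Set.subset_insert _ _).trans (subset_perfectSpan _)) fun heq =>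
      hh (heq ▸ subset_perfectSpan _ (Set.mem_insert _ _)))) ⟨A, rfl⟩ hJP ?_)
  have hPJ' : P ≤ J.colon {h} := by
    refine le_of_hasRegularRelation hgen hJ'P (fun r hr => ?_) fun v m hvm => ?_
    · have hle : perfectSpan s dR (T : Set R) ≤ J.comap (algebraMap R S) :=
        perfectSpan_le (hcomap hJ) fun r hr => subset_perfectSpan _
          (Finset.mem_coe.2 (Finset.mem_union_right _ (Finset.mem_image_of_mem _ hr)))
      exact hJJ' (hle (hT ▸ hr : r ∈ perfectSpan s dR (T : Set R)))
    · obtain ⟨w, hw, hwv, hle⟩ := hF v ⟨m, hvm⟩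
      obtain ⟨hq1, hq2, -, -⟩ := hq w (hFL hw)
      have hdvd : (q w).leadingCoeff * (q w).derivative.eval (y w) ∣ h :=
        Finset.dvd_prod_of_mem (fun v => (q v).leadingCoeff * (q v).derivative.eval (y v)) hw
      have hrel : HasRegularRelation R y (J.colon {h}) w (δ w) :=
        ⟨Nat.pos_of_ne_zero (hδpos w (hFL hw)), q w, hq1, hq2,
          hJJ' (subset_perfectSpan _ (Finset.mem_coe.2
            (Finset.mem_union_left _ (Finset.mem_image_of_mem _ hw)))),
          hreg _ ((Dvd.intro _ rfl).trans hdvd), hreg _ ((Dvd.intro_left _ rfl).trans hdvd)⟩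
      refine ⟨δ w, hle.trans ((hδ v ⟨m, hvm⟩).2 m hvm), ?_⟩
      clear hle hvm
      -- The chosen relation at `w` is carried to `v` one shift at a time, with the same degree
      -- bound.
      induction hwv with
      | refl => exact hrel
      | tail _ hstep ih =>
        obtain ⟨j, rfl⟩ := hstep
        exact ih.shift hy hd (fun j r => ⟨_, hcompat j r⟩) hJ' j
  intro p hp
  have := Submodule.mem_colon_singleton.1 (hPJ' hp)
  rwa [smul_eq_mul, mul_comm] at this

end Basis

/-! ### A basis of `D` with triangular multiplication -/

section AdaptedBasis

variable {K : Type*} [Field K] {D : Type*} [CommRing D] [Algebra K D]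

theorem residueProj_eq_zero_iff (h : HasResidueFieldsK K D) (m : MaximalSpectrum D) (x : D) :
    residueProj h m x = 0 ↔ x ∈ m.asIdeal := by
  rw [residueProj, AlgHom.comp_apply]
  refine (map_eq_zero_iff _ (AlgEquiv.injective _)).trans ?_
  rw [IsScalarTower.coe_toAlgHom', IsScalarTower.algebraMap_apply D (LocalFactor D m)
    (IsLocalRing.ResidueField (LocalFactor D m)), IsLocalRing.ResidueField.algebraMap_eq,
    IsLocalRing.residue_eq_zero_iff]
  exact IsLocalization.AtPrime.to_map_mem_maximal_iff _ m.asIdeal x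

theorem residueProj_injective (h : HasResidueFieldsK K D) :
    Function.Injective (residueProj h) := fun m m' heq =>
  MaximalSpectrum.ext (Ideal.ext fun x => by
    rw [← residueProj_eq_zero_iff h, ← residueProj_eq_zero_iff h, heq])

/-- A proper subspace of the dual of `D`, stable under multiplication by `D`, has an eigenvector
for `D` modulo itself. -/
theorem exists_eigenvector [Module.Finite K D] (h : HasResidueFieldsK K D)
    {V : Submodule K (Module.Dual K D)} (hV : V ≠ ⊤)
    (hstable : ∀ x : D, ∀ f ∈ V, f ∘ₗ LinearMap.mulLeft K x ∈ V) :
    ∃ f ∉ V, ∃ m : MaximalSpectrum D, ∀ x : D,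
      f ∘ₗ LinearMap.mulLeft K x - residueProj h m x • f ∈ V := by
  have : IsArtinianRing D := IsArtinianRing.of_finite K D
  let ann : Module.Dual K D → Ideal D := fun f =>
    { carrier := {x | f ∘ₗ LinearMap.mulLeft K x ∈ V}
      zero_mem' := by simp
      add_mem' := fun {x y} hx hy => by
        have : f ∘ₗ LinearMap.mulLeft K (x + y) =
            f ∘ₗ LinearMap.mulLeft K x + f ∘ₗ LinearMap.mulLeft K y := by
          ext z
          simp [add_mul]
        rw [Set.mem_ofPred_eq, this]
        exact V.add_mem hx hy
      smul_mem' := fun x y hy => by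
        have : f ∘ₗ LinearMap.mulLeft K (x • y) =
            (f ∘ₗ LinearMap.mulLeft K y) ∘ₗ LinearMap.mulLeft K x := by
          ext z
          simp [mul_left_comm]
        rw [Set.mem_ofPred_eq, this]
        exact hstable x _ hy }
  have hann : ∀ f x, x ∈ ann f ↔ f ∘ₗ LinearMap.mulLeft K x ∈ V := fun _ _ => Iff.rfl
  obtain ⟨f₀, hf₀⟩ : ∃ f, f ∉ V := by
    by_contra! hall
    exact hV (eq_top_iff.2 fun f _ => hall f)
  -- As for associated primes: among functionals outside `V`, one whose annihilator modulo `V` is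
  -- maximal has a prime, hence maximal, annihilator, `D` being Artinian.
  obtain ⟨f, hf, hmax⟩ := WellFounded.has_min (wellFounded_gt.onFun (f := ann)) {f | f ∉ V}
    ⟨f₀, hf₀⟩
  have hone : LinearMap.mulLeft K (1 : D) = LinearMap.id := LinearMap.mulLeft_one K D
  have hprime : (ann f).IsPrime := by
    refine ⟨fun htop => hf ?_, fun {a b} hab => ?_⟩
    · have : (1 : D) ∈ ann f := htop ▸ Submodule.mem_top
      rwa [hann, hone, LinearMap.comp_id] at this
    · by_contra! hcon
      have hle : ann f ≤ ann (f ∘ₗ LinearMap.mulLeft K b) := fun x hx => by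
        rw [hann] at hx ⊢
        have : (f ∘ₗ LinearMap.mulLeft K b) ∘ₗ LinearMap.mulLeft K x =
            (f ∘ₗ LinearMap.mulLeft K x) ∘ₗ LinearMap.mulLeft K b := by
          ext z
          simp [mul_left_comm]
        rw [this]
        exact hstable b _ hx
      have hlt : ann f < ann (f ∘ₗ LinearMap.mulLeft K b) := by
        refine lt_of_le_of_ne hle fun heq => hcon.1 ?_
        rw [heq, hann]
        have : (f ∘ₗ LinearMap.mulLeft K b) ∘ₗ LinearMap.mulLeft K a =
            f ∘ₗ LinearMap.mulLeft K (a * b) := by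
          ext z
          simp [mul_left_comm]
        rw [this]
        exact hab
      exact hmax _ hcon.2 hlt
  refine ⟨f, hf, ⟨ann f, inferInstance⟩, fun x => ?_⟩
  set m : MaximalSpectrum D := ⟨ann f, inferInstance⟩
  have hmem : x - algebraMap K D (residueProj h m x) ∈ ann f := by
    refine (residueProj_eq_zero_iff h m _).1 ?_
    rw [map_sub, AlgHom.commutes]
    simp
  rw [hann] at hmem
  convert hmem using 1
  ext z
  simp [m, sub_mul, ← Algebra.smul_def]

/-- A linearly independent family of functionals on `D` which is triangular for the
multiplication of `D` and contains all characters. -/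
structure IsAdapted (h : HasResidueFieldsK K D) {N : ℕ} (f : Fin N → Module.Dual K D)
    (s : Fin N → Fin N) : Prop where
  linearIndependent : LinearIndependent K f
  le_s : ∀ j, j ≤ s j
  exists_eq : ∀ m, ∃ j, s j = j ∧ f j = (residueProj h m).toLinearMap
  eq_char : ∀ j, ∃ m, f (s j) = (residueProj h m).toLinearMap
  triangular : ∀ j, s j ≠ j → ∀ x : D,
    f j ∘ₗ LinearMap.mulLeft K x - f (s j) x • f j ∈ Submodule.span K (f '' Set.Ioi j)

theorem IsAdapted.stable {h : HasResidueFieldsK K D} {N : ℕ} {f : Fin N → Module.Dual K D}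
    {s : Fin N → Fin N} (hf : IsAdapted h f s) (x : D) (g : Module.Dual K D)
    (hg : g ∈ Submodule.span K (Set.range f)) :
    g ∘ₗ LinearMap.mulLeft K x ∈ Submodule.span K (Set.range f) := by
  induction hg using Submodule.span_induction with
  | mem g hg =>
    obtain ⟨j, rfl⟩ := hg
    have hj : f j ∈ Submodule.span K (Set.range f) := Submodule.subset_span ⟨j, rfl⟩
    by_cases hs : s j = j
    · obtain ⟨m, hm⟩ := hf.eq_char j
      rw [hs] at hm
      have : f j ∘ₗ LinearMap.mulLeft K x = residueProj h m x • f j := by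
        ext z
        simp [hm]
      rw [this]
      exact Submodule.smul_mem _ _ hj
    · have := Submodule.span_mono (Set.image_subset_range _ _) (hf.triangular j hs x)
      rw [← sub_add_cancel (f j ∘ₗ LinearMap.mulLeft K x) (f (s j) x • f j)]
      exact Submodule.add_mem _ this (Submodule.smul_mem _ _ hj)
  | zero => simp
  | add g g' _ _ hg hg' =>
    rw [LinearMap.add_comp]
    exact Submodule.add_mem _ hg hg'
  | smul a g _ hg =>
    rw [LinearMap.smul_comp]
    exact Submodule.smul_mem _ _ hg

/-- The new eigenvector is placed at index `0`, below all earlier functionals, and `s` sends it to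
the index of its eigenvalue, already present as a character. -/
theorem IsAdapted.exists_cons [Module.Finite K D] {h : HasResidueFieldsK K D} {N : ℕ}
    {f : Fin N → Module.Dual K D} {s : Fin N → Fin N} (hf : IsAdapted h f s)
    (hspan : Submodule.span K (Set.range f) ≠ ⊤) :
    ∃ (f' : Fin (N + 1) → Module.Dual K D) (s' : Fin (N + 1) → Fin (N + 1)),
      IsAdapted h f' s' := by
  obtain ⟨g, hg, m, hgm⟩ := exists_eigenvector h hspan hf.stable
  obtain ⟨k, hk, hkm⟩ := hf.exists_eq m
  refine ⟨Fin.cons g f, Fin.cons k.succ fun j => (s j).succ,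
    hf.linearIndependent.finCons hg, ?_, ?_, ?_, ?_⟩
  · refine Fin.cases (Fin.zero_le _) fun j => ?_
    simpa using hf.le_s j
  · intro m'
    obtain ⟨j, hj, hjm⟩ := hf.exists_eq m'
    exact ⟨j.succ, by simp [hj], by simp [hjm]⟩
  · refine Fin.cases ⟨m, by simp [hkm]⟩ fun j => ?_
    obtain ⟨m', hm'⟩ := hf.eq_char j
    exact ⟨m', by simp [hm']⟩
  · refine Fin.cases (fun _ x => ?_) fun j hj x => ?_
    · have himage : (Fin.cons g f : Fin (N + 1) → Module.Dual K D) '' Set.Ioi 0 = Set.range f := by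
        ext u
        constructor
        · rintro ⟨i, hi, rfl⟩
          obtain ⟨i, rfl⟩ := Fin.exists_succ_eq.2 (ne_of_gt hi)
          exact ⟨i, by simp⟩
        · rintro ⟨i, rfl⟩
          exact ⟨i.succ, Fin.succ_pos i, by simp⟩
      rw [himage]
      simpa [hkm] using hgm x
    · have hj' : s j ≠ j := fun heq => hj (by simp [heq])
      have hsub : f '' Set.Ioi j ⊆
          (Fin.cons g f : Fin (N + 1) → Module.Dual K D) '' Set.Ioi j.succ := by
        rintro _ ⟨i, hi, rfl⟩
        exact ⟨i.succ, Fin.succ_lt_succ_iff.2 hi, by simp⟩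
      simpa using Submodule.span_mono hsub (hf.triangular j hj' x)

/-- Start from the residue projections, which are independent as distinct characters, and prepend
eigenvectors; the dimension of the dual bounds the length. -/
theorem exists_isAdapted_span_eq_top [Module.Finite K D] (h : HasResidueFieldsK K D) :
    ∃ (N : ℕ) (f : Fin N → Module.Dual K D) (s : Fin N → Fin N),
      IsAdapted h f s ∧ Submodule.span K (Set.range f) = ⊤ := by
  have : Finite (MaximalSpectrum D) := (bijective_toLocalFactors K D).1
  obtain ⟨t, ⟨e⟩⟩ := Finite.exists_equiv_fin (MaximalSpectrum D)
  have hbase : IsAdapted h (fun i => (residueProj h (e.symm i)).toLinearMap) id :=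
    ⟨(linearIndependent_algHom_toLinearMap K D K).comp _
      ((residueProj_injective h).comp e.symm.injective), fun j => le_rfl,
      fun m => ⟨e m, rfl, by simp⟩, fun j => ⟨e.symm j, rfl⟩, fun j hj => absurd rfl hj⟩
  by_contra! hcon
  have hall : ∀ n, ∃ (f : Fin (t + n) → Module.Dual K D) (s : Fin (t + n) → Fin (t + n)),
      IsAdapted h f s := by
    intro n
    induction n with
    | zero => exact ⟨_, _, hbase⟩
    | succ n ih =>
      obtain ⟨f, s, hf⟩ := ih
      exact hf.exists_cons (hcon _ f s hf)
  obtain ⟨f, s, hf⟩ := hall (Module.finrank K (Module.Dual K D) + 1)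
  have := hf.linearIndependent.fintype_card_le_finrank
  rw [Fintype.card_fin] at this
  omega

/-- A basis of `D` whose coordinate functions contain the residue projections, and whose
multiplication is triangular. -/
theorem exists_adapted_basis [Module.Finite K D] (h : HasResidueFieldsK K D) :
    ∃ (N : ℕ) (b : Module.Basis (Fin N) K D) (s : Fin N → Fin N), (∀ j, j ≤ s j) ∧
      (∀ m, ∃ j, b.coord (s j) = (residueProj h m).toLinearMap) ∧
      (∀ j, ∃ m, b.coord (s j) = (residueProj h m).toLinearMap) ∧
      ∀ j, s j ≠ j → ∀ k l, k ≤ j ∨ l ≤ j → b.coord j (b k * b l) =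
        b.coord (s j) (b k) * b.coord j (b l) + b.coord j (b k) * b.coord (s j) (b l) := by
  obtain ⟨N, f, s, hf, hspan⟩ := exists_isAdapted_span_eq_top h
  let B : Module.Basis (Fin N) K (Module.Dual K D) := .mk hf.linearIndependent hspan.ge
  let b : Module.Basis (Fin N) K D := B.dualBasis.map (Module.evalEquiv K D).symm
  have hB : ∀ j, B j = f j := fun j => by simp [B]
  have hfb : ∀ j k, f j (b k) = if j = k then 1 else 0 := fun j k => by
    rw [← hB, Module.Basis.map_apply, Module.apply_evalEquiv_symm_apply,
      Module.Basis.dualBasis_apply_self]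
  have hcoord : ∀ j, b.coord j = f j := fun j => b.ext fun k => by
    rw [hfb, Module.Basis.coord_apply, Module.Basis.repr_self, Finsupp.single_apply]
    simp [eq_comm]
  have hvanish : ∀ j l, l ≤ j → ∀ g ∈ Submodule.span K (f '' Set.Ioi j), g (b l) = 0 := by
    intro j l hl g hg
    induction hg using Submodule.span_induction with
    | mem g hg =>
      obtain ⟨i, hi, rfl⟩ := hg
      rw [hfb, if_neg (hl.trans_lt hi).ne']
    | zero => simp
    | add g g' _ _ hg hg' => simp [hg, hg']
    | smul a g _ hg => simp [hg]
  -- For `l ≤ j` the triangular correction vanishes at `b l`, and so does `f (s j)`, because `l ≤ j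
  -- < s j`. The second Leibniz term is therefore zero and is added only for symmetry in `k` and
  -- `l`.
  have hmul : ∀ j, s j ≠ j → ∀ k l, l ≤ j → f j (b k * b l) =
      f (s j) (b k) * f j (b l) + f j (b k) * f (s j) (b l) := by
    intro j hj k l hl
    have h1 := hvanish j l hl _ (hf.triangular j hj (b k))
    simp only [LinearMap.sub_apply, LinearMap.comp_apply, LinearMap.mulLeft_apply,
      LinearMap.smul_apply, smul_eq_mul, sub_eq_zero] at h1
    have hlt : l < s j := lt_of_le_of_lt hl (lt_of_le_of_ne (hf.le_s j) (Ne.symm hj))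
    rw [h1, hfb (s j) l, if_neg hlt.ne', mul_zero, add_zero]
  refine ⟨N, b, s, hf.le_s, fun m => ?_, fun j => ?_, fun j hj k l hkl => ?_⟩
  · obtain ⟨j, hj, hjm⟩ := hf.exists_eq m
    exact ⟨j, by rw [hj, hcoord, hjm]⟩
  · rw [hcoord]
    exact hf.eq_char j
  · rw [hcoord, hcoord]
    rcases hkl with hk | hl
    · rw [mul_comm, hmul j hj l k hk]
      ring
    · exact hmul j hj k l hl

end AdaptedBasis

/-! ### Operators attached to functionals on `D` -/

section Operators

variable {K : Type*} [Field K] {D : Type*} [CommRing D] [Algebra K D]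

/-- The contraction `R ⊗ D → R` with a functional on `D`. -/
def contract (R : Type*) [CommRing R] [Algebra K R] (f : Module.Dual K D) : R ⊗[K] D →ₗ[K] R :=
  (TensorProduct.rid K R).toLinearMap ∘ₗ f.lTensor R

variable {R : Type*} [CommRing R] [Algebra K R]

theorem contract_tmul (f : Module.Dual K D) (r : R) (x : D) :
    contract R f (r ⊗ₜ[K] x) = f x • r := by
  simp [contract]

/-- The operator on a `𝒟`-ring associated with a functional on `D`. -/
def op (e : R →ₐ[K] R ⊗[K] D) (f : Module.Dual K D) : R →ₗ[K] R :=
  contract R f ∘ₗ e.toLinearMap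

theorem op_apply (e : R →ₐ[K] R ⊗[K] D) (f : Module.Dual K D) (r : R) :
    op e f r = contract R f (e r) := rfl

theorem assocEnd_eq_op (h : HasResidueFieldsK K D) (e : R →ₐ[K] R ⊗[K] D)
    (m : MaximalSpectrum D) (r : R) :
    assocEnd h e m r = op e (residueProj h m).toLinearMap r := by
  rw [op_apply]
  change Algebra.TensorProduct.rid K K R
    (Algebra.TensorProduct.map (AlgHom.id K R) (residueProj h m) (e r)) = _
  induction e r using TensorProduct.induction_on with
  | zero => simp
  | tmul a x => simp [contract_tmul]
  | add z w hz hw => simp only [map_add, hz, hw]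

theorem contract_mapD {S : Type*} [CommRing S] [Algebra K S] (φ : R →ₐ[K] S)
    (f : Module.Dual K D) (z : R ⊗[K] D) :
    contract S f (mapD D φ z) = φ (contract R f z) := by
  induction z using TensorProduct.induction_on with
  | zero => simp
  | tmul a x => simp [contract_tmul]
  | add z w hz hw => simp only [map_add, hz, hw]

theorem contract_contract_rightComm (f g : Module.Dual K D) (z : R ⊗[K] D ⊗[K] D) :
    contract R f (contract (R ⊗[K] D) g (TensorProduct.rightComm K R D D z)) =
      contract R g (contract (R ⊗[K] D) f z) := by
  induction z using TensorProduct.induction_on with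
  | zero => simp
  | tmul w x =>
    induction w using TensorProduct.induction_on with
    | zero => simp
    | tmul r y => simp [contract_tmul, smul_smul, mul_comm]
    | add w w' hw hw' => simp only [TensorProduct.add_tmul, map_add, hw, hw']
  | add z w hz hw => simp only [map_add, hz, hw]

theorem IsDStarRing.op_comm {e : R →ₐ[K] R ⊗[K] D} (he : IsDStarRing e) (f g : Module.Dual K D)
    (r : R) : op e f (op e g r) = op e g (op e f r) := by
  have h : ∀ f g : Module.Dual K D, op e f (op e g r) =
      contract R f (contract (R ⊗[K] D) g (mapD D e (e r))) := fun f g => by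
    rw [op_apply, op_apply, contract_mapD]
  rw [h, h, ← contract_contract_rightComm, he r]

section Basis

variable {ι : Type*} [Fintype ι] (b : Module.Basis ι K D)

theorem eq_sum_contract (z : R ⊗[K] D) : z = ∑ j, contract R (b.coord j) z ⊗ₜ[K] b j := by
  induction z using TensorProduct.induction_on with
  | zero => simp
  | tmul r x =>
    conv_lhs => rw [← b.sum_repr x, TensorProduct.tmul_sum]
    simp [contract_tmul, TensorProduct.smul_tmul']
  | add z w hz hw =>
    conv_lhs => rw [hz, hw]
    simp [TensorProduct.add_tmul, Finset.sum_add_distrib]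

theorem op_eq_sum (e : R →ₐ[K] R ⊗[K] D) (f : Module.Dual K D) (r : R) :
    op e f r = ∑ j, f (b j) • op e (b.coord j) r := by
  conv_lhs => rw [op_apply, eq_sum_contract b (e r)]
  simp only [map_sum, contract_tmul, op_apply]

theorem op_mul (e : R →ₐ[K] R ⊗[K] D) (f : Module.Dual K D) (r r' : R) :
    op e f (r * r') =
      ∑ k, ∑ l, f (b k * b l) • (op e (b.coord k) r * op e (b.coord l) r') := by
  conv_lhs => rw [op_apply, map_mul, eq_sum_contract b (e r), eq_sum_contract b (e r')]
  simp only [Finset.sum_mul_sum, Algebra.TensorProduct.tmul_mul_tmul, map_sum, contract_tmul,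
    op_apply]

theorem isDIdeal_iff (e : R →ₐ[K] R ⊗[K] D) (I : Ideal R) :
    IsDIdeal e I ↔ ∀ j, ∀ a ∈ I, op e (b.coord j) a ∈ I := by
  constructor
  · intro h j a ha
    have hle : I.map (Algebra.TensorProduct.includeLeft : R →ₐ[K] R ⊗[K] D) ≤
        RingHom.ker (mapD D (Ideal.Quotient.mkₐ K I)) := by
      rw [Ideal.map_le_iff_le_comap]
      intro x hx
      have : Ideal.Quotient.mkₐ K I x = 0 := Ideal.Quotient.eq_zero_iff_mem.2 hx
      rw [Ideal.mem_comap, RingHom.mem_ker]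
      simp [this]
    have h0 : mapD D (Ideal.Quotient.mkₐ K I) (e a) = 0 := hle (h a ha)
    have := contract_mapD (Ideal.Quotient.mkₐ K I) (b.coord j) (e a)
    rw [h0, map_zero] at this
    exact Ideal.Quotient.eq_zero_iff_mem.1 this.symm
  · intro h a ha
    rw [eq_sum_contract b (e a)]
    refine Ideal.sum_mem _ fun j _ => ?_
    have : contract R (b.coord j) (e a) ⊗ₜ[K] b j =
        (Algebra.TensorProduct.includeLeft : R →ₐ[K] R ⊗[K] D) (contract R (b.coord j) (e a)) *
          (1 ⊗ₜ[K] b j) := by simp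
    rw [this]
    exact Ideal.mul_mem_right _ _ (Ideal.mem_map_of_mem _ (h j a ha))

theorem isPerfectDIdeal_iff {h : HasResidueFieldsK K D} (e : R →ₐ[K] R ⊗[K] D) {s : ι → ι}
    (h1 : ∀ m, ∃ j, b.coord (s j) = (residueProj h m).toLinearMap)
    (h2 : ∀ j, ∃ m, b.coord (s j) = (residueProj h m).toLinearMap) (I : Ideal R) :
    IsPerfectDIdeal h e I ↔ IsOpPerfect s (fun j => op e (b.coord j)) I := by
  constructor
  · rintro ⟨⟨hD, hrefl⟩, hrad⟩
    refine ⟨(isDIdeal_iff b e I).1 hD, fun j a ha => ?_, hrad⟩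
    obtain ⟨m, hm⟩ := h2 j
    exact hrefl m a (by rwa [assocEnd_eq_op, ← hm])
  · rintro ⟨hD, hrefl, hrad⟩
    refine ⟨⟨(isDIdeal_iff b e I).2 hD, fun m a ha => ?_⟩, hrad⟩
    obtain ⟨j, hj⟩ := h1 m
    exact hrefl j a (by rwa [assocEnd_eq_op, ← hj] at ha)

end Basis

/-- The constants measure the failure of the twisted Leibniz rule on basis elements. By `h3` they
vanish unless both indices exceed `j`, which cuts the double sum down to the triangular range. -/
theorem isTriangular_op {h : HasResidueFieldsK K D} {ι : Type*} [Fintype ι] [LinearOrder ι]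
    (b : Module.Basis ι K D) {s : ι → ι} (hs : ∀ j, j ≤ s j)
    (h2 : ∀ j, ∃ m, b.coord (s j) = (residueProj h m).toLinearMap)
    (h3 : ∀ j, s j ≠ j → ∀ k l, k ≤ j ∨ l ≤ j → b.coord j (b k * b l) =
      b.coord (s j) (b k) * b.coord j (b l) + b.coord j (b k) * b.coord (s j) (b l))
    {e : R →ₐ[K] R ⊗[K] D} (he : IsDStarRing e) :
    IsTriangular s (fun j k l => b.coord j (b k * b l) -
      (b.coord (s j) (b k) * b.coord j (b l) + b.coord j (b k) * b.coord (s j) (b l)))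
      (fun j => op e (b.coord j)) where
  comm i j a := he.op_comm _ _ _
  le_s := hs
  one j := by
    obtain ⟨m, hm⟩ := h2 j
    rw [hm, ← assocEnd_eq_op, map_one]
  mul_s j a a' := by
    obtain ⟨m, hm⟩ := h2 j
    rw [hm]
    simp only [← assocEnd_eq_op, map_mul]
  mul j hj a a' := by
    have hexp : ∀ f g : Module.Dual K D, op e f a * op e g a' =
        ∑ k, ∑ l, (f (b k) * g (b l)) • (op e (b.coord k) a * op e (b.coord l) a') := by
      intro f g
      rw [op_eq_sum b e f, op_eq_sum b e g, Finset.sum_mul_sum]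
      simp only [smul_mul_smul_comm]
    have herr : ∀ k l, (b.coord j (b k * b l) -
        (b.coord (s j) (b k) * b.coord j (b l) + b.coord j (b k) * b.coord (s j) (b l))) •
          (op e (b.coord k) a * op e (b.coord l) a') = if j < k then (if j < l then
        (b.coord j (b k * b l) -
        (b.coord (s j) (b k) * b.coord j (b l) + b.coord j (b k) * b.coord (s j) (b l))) •
          (op e (b.coord k) a * op e (b.coord l) a') else 0) else 0 := by
      intro k l
      split_ifs with hk hl
      · rfl
      · rw [h3 j hj k l (.inr (not_lt.1 hl)), sub_self, zero_smul]
      · rw [h3 j hj k l (.inl (not_lt.1 hk)), sub_self, zero_smul]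
    have hsum : ∑ k with j < k, ∑ l with j < l, (b.coord j (b k * b l) -
        (b.coord (s j) (b k) * b.coord j (b l) + b.coord j (b k) * b.coord (s j) (b l))) •
          (op e (b.coord k) a * op e (b.coord l) a') = ∑ k, ∑ l, (b.coord j (b k * b l) -
        (b.coord (s j) (b k) * b.coord j (b l) + b.coord j (b k) * b.coord (s j) (b l))) •
          (op e (b.coord k) a * op e (b.coord l) a') := by
      rw [Finset.sum_filter]
      refine Finset.sum_congr rfl fun k _ => ?_
      split_ifs with hk
      · rw [Finset.sum_filter]
        refine Finset.sum_congr rfl fun l _ => ?_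
        split_ifs with hl
        · rfl
        · rw [herr k l, if_pos hk, if_neg hl]
      · exact (Finset.sum_eq_zero fun l _ => by rw [herr k l, if_neg hk]).symm
    rw [hsum, hexp, hexp, op_mul b e (b.coord j)]
    simp only [← Finset.sum_add_distrib, ← add_smul]
    refine Finset.sum_congr rfl fun k _ => Finset.sum_congr rfl fun l _ => ?_
    congr 1
    ring

end Operators

/-! ### The operators on the polynomial ring -/

section Polynomials

variable {K : Type*} [Field K] {D : Type*} [CommRing D] [Algebra K D]
variable {R : Type*} [CommRing R] [Algebra K R] {ι : Type*} [Fintype ι] (b : Module.Basis ι K D)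

theorem op_dPolyMap_C (X : Type*) (e : R →ₐ[K] R ⊗[K] D) (f : Module.Dual K D) (r : R) :
    op (dPolyMap X b e) f (MvPolynomial.C r) = MvPolynomial.C (op e f r) := by
  rw [op_apply, dPolyMap_C, contract_mapD]
  rfl

theorem op_dPolyMap_X (X : Type*) (e : R →ₐ[K] R ⊗[K] D) (j : ι) (i : X) (θ : ι →₀ ℕ) :
    op (dPolyMap X b e) (b.coord j) (MvPolynomial.X (i, θ)) =
      MvPolynomial.X (i, θ + Finsupp.single j 1) := by
  classical
  rw [op_apply, dPolyMap_X, map_sum]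
  simp [contract_tmul, Finsupp.single_apply]

theorem rightComm_mapD_mapD {S : Type*} [CommRing S] [Algebra K S] (φ : R →ₐ[K] S)
    (z : R ⊗[K] D ⊗[K] D) :
    TensorProduct.rightComm K S D D (mapD D (mapD D φ) z) =
      mapD D (mapD D φ) (TensorProduct.rightComm K R D D z) := by
  induction z using TensorProduct.induction_on with
  | zero => simp
  | tmul w x =>
    induction w using TensorProduct.induction_on with
    | zero => simp
    | tmul r y => simp
    | add w w' hw hw' => simp only [TensorProduct.add_tmul, map_add, hw, hw']
  | add z w hz hw => simp only [map_add, hz, hw]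

theorem rightComm_mul (z w : R ⊗[K] D ⊗[K] D) :
    TensorProduct.rightComm K R D D (z * w) =
      TensorProduct.rightComm K R D D z * TensorProduct.rightComm K R D D w := by
  induction z using TensorProduct.induction_on with
  | zero => simp
  | add z z' hz hz' => simp only [add_mul, map_add, hz, hz']
  | tmul u x =>
    induction u using TensorProduct.induction_on with
    | zero => simp
    | add u u' hu hu' => simp only [TensorProduct.add_tmul, add_mul, map_add, hu, hu']
    | tmul r y =>
      induction w using TensorProduct.induction_on with
      | zero => simp
      | add w w' hw hw' => simp only [mul_add, map_add, hw, hw']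
      | tmul u x' =>
        induction u using TensorProduct.induction_on with
        | zero => simp
        | add u u' hu hu' => simp only [TensorProduct.add_tmul, mul_add, map_add, hu, hu']
        | tmul r' y' => simp

/-- The `𝒟*`-polynomial ring is a `𝒟*`-ring. -/
theorem isDStarRing_dPolyMap (X : Type*) {e : R →ₐ[K] R ⊗[K] D} (he : IsDStarRing e) :
    IsDStarRing (dPolyMap X b e) := by
  intro p
  induction p using MvPolynomial.induction_on with
  | C r =>
    have : ∀ z, mapD D (dPolyMap X b e)
        (mapD D (IsScalarTower.toAlgHom K R (DPoly X ι R)) z) =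
        mapD D (mapD D (IsScalarTower.toAlgHom K R (DPoly X ι R))) (mapD D e z) := by
      intro z
      induction z using TensorProduct.induction_on with
      | zero => simp
      | tmul r x =>
        have := dPolyMap_C X b e r
        simpa using congrArg (· ⊗ₜ[K] x) this
      | add z w hz hw => simp only [map_add, hz, hw]
    rw [dPolyMap_C, this, rightComm_mapD_mapD, he r]
  | add p q hp hq => simp only [map_add, hp, hq]
  | mul_X p iθ hp =>
    obtain ⟨i, θ⟩ := iθ
    have : mapD D (dPolyMap X b e) (dPolyMap X b e (MvPolynomial.X (i, θ))) =
        ∑ j, ∑ k, ((MvPolynomial.X (i, θ + Finsupp.single j 1 + Finsupp.single k 1) :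
          DPoly X ι R) ⊗ₜ[K] b k) ⊗ₜ[K] b j := by
      rw [dPolyMap_X, map_sum]
      refine Finset.sum_congr rfl fun j _ => ?_
      rw [Algebra.TensorProduct.map_tmul, AlgHom.coe_id, id_eq, dPolyMap_X, TensorProduct.sum_tmul]
    rw [map_mul, map_mul, rightComm_mul, hp, this]
    congr 1
    simp only [map_sum, TensorProduct.rightComm_tmul]
    rw [Finset.sum_comm]
    refine Finset.sum_congr rfl fun j _ => Finset.sum_congr rfl fun k _ => ?_
    rw [add_right_comm]

/-- A subalgebra of the `𝒟*`-polynomial ring stable under the operators and containing the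
indeterminates is everything. -/
theorem eq_top_of_op_mem {X : Type*} {e : R →ₐ[K] R ⊗[K] D} (B : Subalgebra R (DPoly X ι R))
    (h0 : ∀ i, MvPolynomial.X (i, 0) ∈ B)
    (hB : ∀ j, ∀ p ∈ B, op (dPolyMap X b e) (b.coord j) p ∈ B) : B = ⊤ := by
  have hX : ∀ (i : X) (θ θ₀ : ι →₀ ℕ), (MvPolynomial.X (i, θ₀) : DPoly X ι R) ∈ B →
      (MvPolynomial.X (i, θ₀ + θ) : DPoly X ι R) ∈ B := by
    intro i θ
    induction θ using Finsupp.induction_linear with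
    | zero => simp
    | add θ θ' hθ hθ' =>
      intro θ₀ h
      rw [← add_assoc]
      exact hθ' _ (hθ _ h)
    | single j m =>
      intro θ₀ h
      induction m with
      | zero => simpa using h
      | succ m ih =>
        rw [Finsupp.single_add, ← add_assoc, ← op_dPolyMap_X b X e]
        exact hB j _ ih
  rw [eq_top_iff, ← MvPolynomial.adjoin_range_X, Algebra.adjoin_le_iff]
  rintro _ ⟨⟨i, θ⟩, rfl⟩
  simpa using hX i θ 0 (h0 i)

end Polynomials

end DStar

end


/-! ### The basis theorem for `D`-rings -/

theorem mainTheorem1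
    {K : Type*} [Field K] {D : Type*} [CommRing D] [Algebra K D] [Module.Finite K D]
    {R : Type*} [CommRing R] [Algebra K R] [Algebra ℚ R]
    (hres : DStar.HasResidueFieldsK K D)
    (e : R →ₐ[K] TensorProduct K R D) (he : DStar.IsDStarRing e)
    (hinj : ∀ m : MaximalSpectrum D, Function.Injective (DStar.assocEnd hres e m))
    (hacc : DStar.ACCPerfect hres e)
    {ι : Type*} [Fintype ι] (b : Module.Basis ι K D) (n : ℕ) :
    DStar.ACCPerfect hres (DStar.dPolyMap (Fin n) b e) := by
  obtain ⟨N, b', s, hs, h1, h2, h3⟩ := DStar.exists_adapted_basis hres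
  have hd := DStar.isTriangular_op b' hs h2 h3 (DStar.isDStarRing_dPolyMap b (Fin n) he)
  have hcompat : ∀ j r, DStar.op (DStar.dPolyMap (Fin n) b e) (b'.coord j)
      (algebraMap R (DStar.DPoly (Fin n) ι R) r) =
      algebraMap R _ (DStar.op e (b'.coord j) r) := fun j r => DStar.op_dPolyMap_C b _ e _ r
  -- The variables used are the derivatives of the indeterminates under the adapted basis `b'`, not
  -- the given `d^θ x_k` belonging to `b`. Algebraic independence is not needed, only generation.
  obtain ⟨y, hy, hy0⟩ := DStar.exists_isVariableSystem hd.comm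
    (fun k : Fin n => (MvPolynomial.X (k, 0) : DStar.DPoly (Fin n) ι R))
  have hstep : ∀ j, ∀ p ∈ Algebra.adjoin R (Set.range y),
      DStar.op (DStar.dPolyMap (Fin n) b e) (b'.coord j) p ∈ Algebra.adjoin R (Set.range y) :=
    fun j p hp => DStar.op_mem_of_mem_adjoin hd (fun j r => ⟨_, hcompat j r⟩) (j := j)
      (fun k _ a ha => by
        obtain ⟨v, rfl⟩ := ha
        rw [hy.op_var]
        exact Algebra.subset_adjoin ⟨_, rfl⟩) hp j le_rfl
  have hgen : Algebra.adjoin R (Set.range y) = ⊤ := by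
    refine DStar.eq_top_of_op_mem b (e := e) _ (fun k => ?_) fun j p hp => ?_
    · rw [← hy0]
      exact Algebra.subset_adjoin ⟨_, rfl⟩
    -- The operators of `b` are `K`-linear combinations of those of `b'`, so they preserve the
    -- algebra generated by `y`.
    · rw [DStar.op_eq_sum b']
      refine sum_mem fun k _ => ?_
      rw [← algebraMap_smul R]
      exact Subalgebra.smul_mem _ (hstep k p hp) _
  have hR : ∀ I : Ideal R, DStar.IsOpPerfect s (fun j => DStar.op e (b'.coord j)) I →
      DStar.PerfectFG s (fun j => DStar.op e (b'.coord j)) I := fun I hI =>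
    DStar.perfectFG_of_stable (fun C hC hperf => hacc C hC fun k =>
      (DStar.isPerfectDIdeal_iff b' e h1 h2 _).2 (hperf k)) hI
  exact fun C hC hperf => DStar.exists_stable_of_perfectFG
    (DStar.perfectFG_of_adjoin_eq_top hd hcompat hR hy hgen) C hC
    fun k => (DStar.isPerfectDIdeal_iff b' _ h1 h2 _).1 (hperf k)
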